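/- Let $0<y<\tfrac12$, $\alpha_c=\frac{1-\sqrt{1-4y^2}}{2y}$ and $0\le\alpha<\alpha_c$. On the Fock space $\mathbb F_{ab}=\ell^2(\mathbb N\times\mathbb N)$ with orthonormal basis $|m,n\rangle$ and the annihilation and creation operators $a,b,a^*,b^*$ of two boson species, let $$H_{ab}=\tfrac12(a^*a+b^*b)+y(a^*b^*+ab),\qquad H_{ab}^{(\alpha)}=\frac{1}{1-2\alpha y}\Big(e^{\alpha a^*b^*}H_{ab}\,e^{-\alpha a^*b^*}+\alpha y\Big),$$ where the operators act on formal series $\sum c_{m,n}|m,n\rangle$ (each coefficient of the image is a finite sum) and each of the two Hamiltonians is taken with its maximal domain $\{\Psi\in\mathbb F_{ab}: H\Psi\in\mathbb F_{ab}\}$. Let $\sigma_p$ denote the point spectrum (the set of eigenvalues). Put $y_1=\frac{y}{1-2\alpha y}$, $y_2=\frac{y-\alpha+\alpha^2y}{1-2\alpha y}$ and $z_\pm=\frac{-1\pm\sqrt{1-4y_1y_2}}{2y_2}$ (so that $z_-<z_+<0$ and $z_-<-1$), and assume $|z_+|<1$. For an integer $p>0$, a constant $C_0\in\mathbb C\setminus\{0\}$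 and $B\in\mathbb C$, put $C=p-1-B$ and $$I(z)=\frac{C_0y_1p}{y_2}(z-z_+)^B(z-z_-)^C\int_0^z u^{p-1}(u-z_+)^{-(1+B)}(u-z_-)^{-(1+C)}\,du,\qquad G(z)=z^{-p}I(z),$$ with principal branches and integration along a segment, for $z\ne0$ in the unit disk slit along $(-1,z_+]$. Such a function is called analytic in the unit disk if it extends from this set to an analytic function on $\{|z|<1\}$. Then: 1. $G$ is analytic in the unit disk if and only if $B\in\mathbb N$ and $B\ge p$; the same equivalence holds for $I$. 2. Let $p>0$, and let $\Psi=\sum_{s\ge0}c_s|p+s,s\rangle\in\mathbb F_{ab}$ (or $\Psi=\sum_{s\ge0}c_s|s,p+s\rangle$) be an eigenvector of $H^{(\alpha)}_{ab}$ with eigenvalue $E$, and let $C_s=\sqrt{s!/(p+s)!}\,c_s$. Then $C_0\neq0$, and the generating function $\sum_{s\ge0}C_sz^s$ of $\Psi$ equals $G(z)$ for all $z\ne 0$ in the slit disk, for this $C_0$ and the exponent $$B=\frac{(p/2-E-1)z_++y_1(p-1)}{z_++2y_1}.$$ 3. $\sigma_p(H^{(\alpha)}_{ab})$ is a closed discrete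 subset of $\mathbb C$. 4. $(1-2\alpha y)\,\sigma_p(H^{(\alpha)}_{ab})-\alpha y=\sigma_p(H_{ab})$, and this set is the Bogoliubov spectrum $$\Big\{\tfrac12(n_a+n_b)\sqrt{1-4y^2}+\tfrac12\big(\sqrt{1-4y^2}-1\big):\ n_a,n_b\in\mathbb N\Big\}.$$ -/

import Mathlib

open scoped ENNReal

noncomputable section

namespace TwoSpecies

/-! ### The two-species Fock space and its operators -/

/-- Formal vectors `∑ Φ (m, n) |m, n⟩`, with no summability condition. -/
abbrev Formal : Type := ℕ × ℕ → ℂ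

/-- The Fock space of two particle species: the square summable formal vectors. The orthonormal
basis vector `|m, n⟩` is the indicator of `(m, n)`. -/
abbrev Fock : Type := lp (fun _ : ℕ × ℕ => ℂ) 2

/-- The annihilation operator `a`, with `a |m, n⟩ = √m |m - 1, n⟩`. -/
def annA : Module.End ℂ Formal where
  toFun Φ x := (√((x.1 : ℝ) + 1) : ℂ) * Φ (x.1 + 1, x.2)
  map_add' Φ Ψ := by ext x; simp [mul_add]
  map_smul' c Φ := by ext x; simp [mul_left_comm]

/-- The annihilation operator `b`, with `b |m, n⟩ = √n |m, n - 1⟩`. -/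
def annB : Module.End ℂ Formal where
  toFun Φ x := (√((x.2 : ℝ) + 1) : ℂ) * Φ (x.1, x.2 + 1)
  map_add' Φ Ψ := by ext x; simp [mul_add]
  map_smul' c Φ := by ext x; simp [mul_left_comm]

/-- The creation operator `a*`, with `a* |m, n⟩ = √(m + 1) |m + 1, n⟩`. The truncated subtraction
at `x.1 = 0` is harmless because its coefficient `√0` vanishes. -/
def creA : Module.End ℂ Formal where
  toFun Φ x := (√(x.1 : ℝ) : ℂ) * Φ (x.1 - 1, x.2)
  map_add' Φ Ψ := by ext x; simp [mul_add]
  map_smul' c Φ := by ext x; simp [mul_left_comm]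

/-- The creation operator `b*`, with `b* |m, n⟩ = √(n + 1) |m, n + 1⟩`. -/
def creB : Module.End ℂ Formal where
  toFun Φ x := (√(x.2 : ℝ) : ℂ) * Φ (x.1, x.2 - 1)
  map_add' Φ Ψ := by ext x; simp [mul_add]
  map_smul' c Φ := by ext x; simp [mul_left_comm]

/-- The exponential `exp (t a* b*)` on formal vectors. The coefficient of `(a* b*) ^ j Φ` at
`(m, n)` vanishes as soon as `j > min m n`, so the exponential series is a finite sum in each
coefficient. -/
def expPair (t : ℂ) : Module.End ℂ Formal where
  toFun Φ x := ∑ j ∈ Finset.range (min x.1 x.2 + 1),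
    t ^ j / (j.factorial : ℂ) * ((creA * creB) ^ j) Φ x
  map_add' Φ Ψ := by ext x; simp [mul_add, Finset.sum_add_distrib]
  map_smul' c Φ := by
    ext x
    simp only [map_smul, Pi.smul_apply, smul_eq_mul, RingHom.id_apply, Finset.mul_sum]
    exact Finset.sum_congr rfl fun j _ => by ring

/-- The Hamiltonian `H_ab(y) = (a* a + b* b) / 2 + y (a* b* + a b)`. -/
def hamiltonian (y : ℝ) : Module.End ℂ Formal :=
  (1 / 2 : ℂ) • (creA * annA + creB * annB) + (y : ℂ) • (creA * creB + annA * annB)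

/-- The rescaled transformed Hamiltonian
`(1 - 2 α y)⁻¹ (exp (α a* b*) H_ab exp (-α a* b*) + α y)`. -/
def transformedHamiltonian (y α : ℝ) : Module.End ℂ Formal :=
  (1 / (1 - 2 * α * y) : ℂ) •
    (expPair α * hamiltonian y * expPair (-α) + (α * y : ℂ) • (1 : Module.End ℂ Formal))

/-- The unbounded operator on Fock space given by a formal operator `T` on its maximal domain
`{Ψ ∈ Fock | T Ψ ∈ Fock}`. -/
def realize (T : Module.End ℂ Formal) : Fock →ₗ.[ℂ] Fock where
  domain :=
    { carrier := {Ψ | Memℓp (T (Ψ : Formal)) 2}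
      add_mem' := by
        intro Φ Ψ hΦ hΨ
        have h : T ((Φ + Ψ : Fock) : Formal) = T (Φ : Formal) + T (Ψ : Formal) := by
          rw [← map_add]; rfl
        simpa only [Set.mem_ofPred_eq, h] using Memℓp.add hΦ hΨ
      zero_mem' := by
        have h : T ((0 : Fock) : Formal) = 0 := map_zero T
        simpa only [Set.mem_ofPred_eq, h] using
          (zero_memℓp : Memℓp (0 : ∀ _ : ℕ × ℕ, ℂ) 2)
      smul_mem' := by
        intro c Ψ hΨ
        have h : T ((c • Ψ : Fock) : Formal) = c • T (Ψ : Formal) := by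
          rw [← map_smul]; rfl
        simpa only [Set.mem_ofPred_eq, h] using Memℓp.const_smul hΨ c }
  toFun :=
    { toFun := fun Ψ => ⟨T ((Ψ : Fock) : Formal), Ψ.2⟩
      map_add' := fun Φ Ψ => Subtype.ext (map_add T ((Φ : Fock) : Formal) ((Ψ : Fock) : Formal))
      map_smul' := fun c Ψ => Subtype.ext (map_smul T c ((Ψ : Fock) : Formal)) }

/-- `Ψ` is an eigenvector of the unbounded operator `T`, with eigenvalue `E`. -/
def IsEigenstate (T : Fock →ₗ.[ℂ] Fock) (E : ℂ) (Ψ : Fock) : Prop :=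
  Ψ ≠ 0 ∧ ∃ h : Ψ ∈ T.domain, T ⟨Ψ, h⟩ = E • Ψ

/-- The point spectrum `σ_p(T)`: the set of eigenvalues. -/
def pointSpectrum (T : Fock →ₗ.[ℂ] Fock) : Set ℂ :=
  {E | ∃ Ψ : Fock, IsEigenstate T E Ψ}

/-! ### Parameters -/

/-- The critical parameter `α_c`. -/
def alphaC (y : ℝ) : ℝ := (1 - √(1 - 4 * y ^ 2)) / (2 * y)

/-- The coefficient `y₁(α)` of `a b`. -/
def y₁ (y α : ℝ) : ℝ := y / (1 - 2 * α * y)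

/-- The coefficient `y₂(α)` of `a* b*`. -/
def y₂ (y α : ℝ) : ℝ := (y - α + α ^ 2 * y) / (1 - 2 * α * y)

/-- The root `z₊(α)` of `y₂ z ^ 2 + z + y₁`. -/
def zPlus (y α : ℝ) : ℝ := (-1 + √(1 - 4 * y₁ y α * y₂ y α)) / (2 * y₂ y α)

/-- The root `z₋(α)` of `y₂ z ^ 2 + z + y₁`. -/
def zMinus (y α : ℝ) : ℝ := (-1 - √(1 - 4 * y₁ y α * y₂ y α)) / (2 * y₂ y α)

/-- The exponent `B` that belongs to the energy `E`. -/
def exponentB (y α : ℝ) (p : ℕ) (E : ℂ) : ℂ :=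
  (((p : ℂ) / 2 - E - 1) * zPlus y α + y₁ y α * ((p : ℂ) - 1)) / (zPlus y α + 2 * y₁ y α)

/-! ### Generating functions -/

/-- The basis labels `s ↦ (p + s, s)`, spanning the fibre where `a* a - b* b = p`. -/
def fibrePos (p : ℕ) (s : ℕ) : ℕ × ℕ := (p + s, s)

/-- The basis labels `s ↦ (s, p + s)`, spanning the fibre where `b* b - a* a = p`. -/
def fibreNeg (p : ℕ) (s : ℕ) : ℕ × ℕ := (s, p + s)

/-- The rescaled coefficients `C_s = √(s! / (p + s)!) c_s` of a vector `∑ c_s |ι s⟩`, where `ι` is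
one of the two fibres. -/
def rescaledCoeff (p : ℕ) (ι : ℕ → ℕ × ℕ) (Ψ : Fock) (s : ℕ) : ℂ :=
  (√((s.factorial : ℝ) / ((p + s).factorial : ℝ)) : ℂ) * (Ψ : Formal) (ι s)

/-- The function
`(C₀ y₁ p / y₂) (z - z₊)^B (z - z₋)^C ∫₀ᶻ u^(p-1) (u - z₊)^(-(1+B)) (u - z₋)^(-(1+C)) du`,
`C = p - 1 - B`, with principal branches, the contour being the segment `u = t z`, `0 ≤ t ≤ 1`. -/
def integralFormula (y α : ℝ) (p : ℕ) (C₀ B z : ℂ) : ℂ :=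
  C₀ * y₁ y α * p / y₂ y α * (z - zPlus y α) ^ B * (z - zMinus y α) ^ ((p : ℂ) - 1 - B) *
    ∫ t in (0 : ℝ)..1,
      ((t * z) ^ (p - 1) * (t * z - zPlus y α) ^ (-(1 + B)) *
        (t * z - zMinus y α) ^ (-(1 + ((p : ℂ) - 1 - B)))) * z

/-- The generating function `z^(-p) * integralFormula`. -/
def genFun (y α : ℝ) (p : ℕ) (C₀ B z : ℂ) : ℂ :=
  integralFormula y α p C₀ B z / z ^ p

/-- The unit disk without `0` and without the ray `(-∞, z₊]`. With `z₋ < z₊ < 0`, the slit disk is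
star-shaped about `0` and carries holomorphic principal branches of the powers of `z - z₊` and
`z - z₋`. -/
def slitDisk (y α : ℝ) : Set ℂ :=
  {z | ‖z‖ < 1 ∧ z ≠ 0 ∧ z - zPlus y α ∈ Complex.slitPlane}

/-- `G`, given on the slit disk, is analytic in the unit disk: it has no singularity there other
than removable ones. -/
def AnalyticInDisk (y α : ℝ) (G : ℂ → ℂ) : Prop :=
  ∃ F : ℂ → ℂ, AnalyticOnNhd ℂ F (Metric.ball 0 1) ∧ Set.EqOn F G (slitDisk y α)

/-- The Bogoliubov spectrum of `H_ab(y)`: quanta of energy `√(1 - 4 y ^ 2) / 2` of two species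
above the ground state energy `(√(1 - 4 y ^ 2) - 1) / 2`. -/
def bogoliubovSpectrum (y : ℝ) : Set ℂ :=
  {E | ∃ na nb : ℕ, E = (((na + nb : ℝ) / 2 * √(1 - 4 * y ^ 2) +
    (√(1 - 4 * y ^ 2) - 1) / 2 : ℝ) : ℂ)}

end TwoSpecies

end

open TwoSpecies

/-!
The transform `|p + s, s⟩ ↦ z ^ s / √(s! (p + s)!)` identifies each fibre of the Fock space with
power series on which `a* b*` multiplies by `z`. Conjugation by `exp (α a* b*)` is then conjugation
by the exponential series, and both Hamiltonians become members of one family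
`(a* a + b* b) / 2 + β a b + γ a* b*`.

On a fibre, an eigenvector of such an operator is a three-term recurrence for the rescaled
coefficients `C_s`. The function `F = ∑ C_s z ^ (p + s)` is analytic in the unit disk, since the
`C_s` are bounded, and the recurrence says that it satisfies a first-order equation with the two
regular singular points `z₊` and `z₋`, of which only `z₊` lies in the disk. Variation of constants
gives the integral formula. The equation behaves well under differentiation: its `p`-th derivative
is homogeneous, with exponent `B - p` at `z₊`. A nonzero solution that is analytic at `z₊` therefore
exists only for `B - p ∈ ℕ`, and this quantizes the energy. Conversely, the vectors with
`C_s = z₋⁻ˢ` on the fibres realize all the admissible energies.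
-/

namespace TwoSpecies

open Filter Topology Metric Set
open scoped Nat PowerSeries

/-! ### The Bargmann transform on a fibre -/

theorem ofReal_sqrt_mul_self {x : ℝ} (hx : 0 ≤ x) : (√x : ℂ) * √x = x := by
  rw [← Complex.ofReal_mul, Real.mul_self_sqrt hx]

theorem creA_mul_annA_apply (Φ : Formal) (x : ℕ × ℕ) : (creA * annA) Φ x = x.1 * Φ x := by
  rcases x with ⟨- | m, n⟩
  · simp [creA]
  · simp [creA, annA, ← mul_assoc, ofReal_sqrt_mul_self (show 0 ≤ (m : ℝ) + 1 by positivity)]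

theorem creB_mul_annB_apply (Φ : Formal) (x : ℕ × ℕ) : (creB * annB) Φ x = x.2 * Φ x := by
  rcases x with ⟨m, - | n⟩
  · simp [creB]
  · simp [creB, annB, ← mul_assoc, ofReal_sqrt_mul_self (show 0 ≤ (n : ℝ) + 1 by positivity)]

theorem annA_mul_annB_apply (Φ : Formal) (x : ℕ × ℕ) :
    (annA * annB) Φ x = √((x.1 : ℝ) + 1) * √((x.2 : ℝ) + 1) * Φ (x.1 + 1, x.2 + 1) :=
  (mul_assoc _ _ _).symm

theorem creA_mul_creB_apply (Φ : Formal) (x : ℕ × ℕ) :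
    (creA * creB) Φ x = √(x.1 : ℝ) * √(x.2 : ℝ) * Φ (x.1 - 1, x.2 - 1) :=
  (mul_assoc _ _ _).symm

/-- The norm of `(a*) ^ (p + s) (b*) ^ s |0, 0⟩`. -/
noncomputable def fibreNorm (p s : ℕ) : ℂ := √((p + s)! : ℝ) * √(s ! : ℝ)

theorem fibreNorm_ne_zero (p s : ℕ) : fibreNorm p s ≠ 0 := by
  simp [fibreNorm, Nat.factorial_ne_zero]

theorem fibreNorm_succ (p s : ℕ) :
    fibreNorm p (s + 1) = √((p : ℝ) + s + 1) * √((s : ℝ) + 1) * fibreNorm p s := by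
  simp only [fibreNorm, ← add_assoc, Nat.factorial_succ, Nat.cast_mul, Nat.cast_add, Nat.cast_one]
  rw [Real.sqrt_mul (by positivity), Real.sqrt_mul (by positivity)]
  push_cast
  ring

/-- The Bargmann transform of a formal vector along the fibre `ι`: the power series `f` for which
`∑ Φ (ι s) |ι s⟩` is `f (a* b*)` applied to `(a*) ^ p |0, 0⟩` or `(b*) ^ p |0, 0⟩`. It turns the
operators below into differential operators. -/
noncomputable def fibreSeries (p : ℕ) (ι : ℕ → ℕ × ℕ) : Formal →ₗ[ℂ] ℂ⟦X⟧ where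
  toFun Φ := .mk fun s => Φ (ι s) / fibreNorm p s
  map_add' Φ Ψ := by ext; simp [add_div]
  map_smul' c Φ := by ext; simp [mul_div_assoc]

theorem coeff_fibreSeries (p : ℕ) (ι : ℕ → ℕ × ℕ) (Φ : Formal) (s : ℕ) :
    PowerSeries.coeff s (fibreSeries p ι Φ) = Φ (ι s) / fibreNorm p s := by
  simp [fibreSeries]

theorem derivative_rescale_exp (t : ℂ) :
    d⁄dX ℂ (PowerSeries.rescale t (PowerSeries.exp ℂ)) =
      t • PowerSeries.rescale t (PowerSeries.exp ℂ) := by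
  ext n
  simp only [PowerSeries.coeff_derivative, PowerSeries.coeff_rescale, PowerSeries.coeff_exp,
    PowerSeries.coeff_smul, smul_eq_mul, Nat.factorial_succ, pow_succ', map_div₀, map_one,
    map_natCast]
  push_cast
  field_simp

theorem derivative_rescale_exp_mul (t : ℂ) (f : ℂ⟦X⟧) :
    d⁄dX ℂ (PowerSeries.rescale t (PowerSeries.exp ℂ) * f) =
      PowerSeries.rescale t (PowerSeries.exp ℂ) * (d⁄dX ℂ f + t • f) := by
  rw [Derivation.leibniz, derivative_rescale_exp, smul_eq_mul, smul_eq_mul, mul_add,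
    mul_smul_comm, mul_smul_comm, mul_comm f]

theorem rescale_exp_mul_rescale_exp_neg (t : ℂ) :
    PowerSeries.rescale t (PowerSeries.exp ℂ) * PowerSeries.rescale (-t) (PowerSeries.exp ℂ) =
      1 := by
  rw [PowerSeries.exp_mul_exp_eq_exp_add, add_neg_cancel]
  ext n
  rcases n with - | n <;> simp

theorem exists_fibre (x : ℕ × ℕ) :
    ∃ (p : ℕ) (ι : ℕ → ℕ × ℕ) (s : ℕ), (ι = fibrePos p ∨ ι = fibreNeg p) ∧ ι s = x := by
  rcases le_total x.2 x.1 with h | h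
  · exact ⟨x.1 - x.2, _, x.2, .inl rfl, Prod.ext (Nat.sub_add_cancel h) rfl⟩
  · exact ⟨x.2 - x.1, _, x.1, .inr rfl, Prod.ext rfl (Nat.sub_add_cancel h)⟩

theorem ext_fibreSeries {Φ Ψ : Formal}
    (h : ∀ p ι, (ι = fibrePos p ∨ ι = fibreNeg p) → fibreSeries p ι Φ = fibreSeries p ι Ψ) :
    Φ = Ψ := by
  funext x
  obtain ⟨p, ι, s, hι, rfl⟩ := exists_fibre x
  have := congrArg (PowerSeries.coeff s) (h p ι hι)
  rwa [coeff_fibreSeries, coeff_fibreSeries, div_left_inj' (fibreNorm_ne_zero p s)] at this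

/-- The number operator `a* a + b* b`. -/
noncomputable def numberOperator : Module.End ℂ Formal := creA * annA + creB * annB

theorem numberOperator_apply (Φ : Formal) (x : ℕ × ℕ) :
    numberOperator Φ x = (x.1 + x.2) * Φ x := by
  rw [numberOperator, LinearMap.add_apply, Pi.add_apply, creA_mul_annA_apply, creB_mul_annB_apply,
    add_mul]

section Fibre

variable {p : ℕ} {ι : ℕ → ℕ × ℕ} (hι : ι = fibrePos p ∨ ι = fibreNeg p) (Φ : Formal)
include hι

theorem fibreSeries_number :
    fibreSeries p ι (numberOperator Φ) =
      p • fibreSeries p ι Φ + 2 • (PowerSeries.X * d⁄dX ℂ (fibreSeries p ι Φ)) := by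
  have number_apply (s : ℕ) : numberOperator Φ (ι s) = (p + 2 * s) * Φ (ι s) := by
    rw [numberOperator_apply]
    rcases hι with rfl | rfl <;> simp only [fibrePos, fibreNeg, Nat.cast_add] <;> ring
  ext s
  rw [coeff_fibreSeries, number_apply, map_add, map_nsmul, map_nsmul, coeff_fibreSeries]
  rcases s with - | s
  · simp [mul_div_assoc]
  · rw [PowerSeries.coeff_succ_X_mul, PowerSeries.coeff_derivative, coeff_fibreSeries]
    simp only [nsmul_eq_mul]
    push_cast
    ring

theorem fibreSeries_creation :
    fibreSeries p ι ((creA * creB) Φ) = PowerSeries.X * fibreSeries p ι Φ := by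
  ext s
  rw [coeff_fibreSeries, creA_mul_creB_apply]
  rcases s with - | s
  · rcases hι with rfl | rfl <;> simp [fibrePos, fibreNeg]
  · rw [PowerSeries.coeff_succ_X_mul, coeff_fibreSeries,
      div_eq_div_iff (fibreNorm_ne_zero _ _) (fibreNorm_ne_zero _ _), fibreNorm_succ]
    rcases hι with rfl | rfl <;> simp only [fibrePos, fibreNeg, ← add_assoc, Nat.add_sub_cancel] <;>
      push_cast <;> ring

theorem fibreSeries_annihilation :
    fibreSeries p ι ((annA * annB) Φ) =
      PowerSeries.X * d⁄dX ℂ (d⁄dX ℂ (fibreSeries p ι Φ)) +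
        (p + 1) • d⁄dX ℂ (fibreSeries p ι Φ) := by
  have coeff_annihilation (s : ℕ) : (annA * annB) Φ (ι s) / fibreNorm p s =
      (p + s + 1) * (s + 1) * (Φ (ι (s + 1)) / fibreNorm p (s + 1)) := by
    have hp := ofReal_sqrt_mul_self (show 0 ≤ (p : ℝ) + s + 1 by positivity)
    have hs := ofReal_sqrt_mul_self (show 0 ≤ (s : ℝ) + 1 by positivity)
    push_cast at hp hs
    rw [annA_mul_annB_apply, ← mul_div_assoc,
      div_eq_div_iff (fibreNorm_ne_zero _ _) (fibreNorm_ne_zero _ _), fibreNorm_succ, ← hp, ← hs]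
    rcases hι with rfl | rfl <;> simp only [fibrePos, fibreNeg, ← add_assoc] <;> push_cast <;> ring
  ext s
  rw [coeff_fibreSeries, coeff_annihilation, map_add, map_nsmul, PowerSeries.coeff_derivative,
    coeff_fibreSeries]
  rcases s with - | s
  · simp
  · rw [PowerSeries.coeff_succ_X_mul, PowerSeries.coeff_derivative, PowerSeries.coeff_derivative,
      coeff_fibreSeries]
    simp only [nsmul_eq_mul]
    push_cast
    ring

theorem fibreSeries_creation_pow (j : ℕ) :
    fibreSeries p ι (((creA * creB) ^ j) Φ) = PowerSeries.X ^ j * fibreSeries p ι Φ := by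
  induction j with
  | zero => simp
  | succ j ih =>
    rw [pow_succ', Module.End.mul_apply, fibreSeries_creation hι, ih, pow_succ', mul_assoc]

theorem fibreSeries_expPair (t : ℂ) :
    fibreSeries p ι (expPair t Φ) =
      PowerSeries.rescale t (PowerSeries.exp ℂ) * fibreSeries p ι Φ := by
  ext s
  have hmin : min (ι s).1 (ι s).2 = s := by rcases hι with rfl | rfl <;> simp [fibrePos, fibreNeg]
  have hpow (j : ℕ) (hj : j ∈ Finset.range (s + 1)) :
      ((creA * creB) ^ j) Φ (ι s) / fibreNorm p s =
        PowerSeries.coeff (s - j) (fibreSeries p ι Φ) := by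
    rw [← coeff_fibreSeries, fibreSeries_creation_pow hι, PowerSeries.coeff_X_pow_mul',
      if_pos (Finset.mem_range_succ_iff.1 hj)]
  rw [coeff_fibreSeries, PowerSeries.coeff_mul, Finset.Nat.sum_antidiagonal_eq_sum_range_succ_mk]
  simp only [expPair, LinearMap.coe_mk, AddHom.coe_mk, hmin, Finset.sum_div]
  refine Finset.sum_congr rfl fun j hj => ?_
  rw [mul_div_assoc, hpow j hj]
  simp [PowerSeries.coeff_rescale, PowerSeries.coeff_exp, div_eq_mul_inv]

end Fibre

/-- The operator `(a* a + b* b) / 2 + β a b + γ a* b*`, the common form of the two Hamiltonians. -/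
noncomputable def pairOperator (β γ : ℂ) : Module.End ℂ Formal :=
  (1 / 2 : ℂ) • numberOperator + β • (annA * annB) + γ • (creA * creB)

theorem hamiltonian_eq_pairOperator (y : ℝ) : hamiltonian y = pairOperator y y := by
  rw [hamiltonian, pairOperator, numberOperator]
  module

theorem expPair_conj_pairOperator (β γ t : ℂ) :
    expPair t * pairOperator β γ * expPair (-t) =
      ((1 - 2 * β * t) / 2) • numberOperator + β • (annA * annB) +
        (γ - t + β * t ^ 2) • (creA * creB) - (β * t) • 1 := by
  refine LinearMap.ext fun Φ => ext_fibreSeries fun p ι hι => ?_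
  have cancel (f : ℂ⟦X⟧) : PowerSeries.rescale t (PowerSeries.exp ℂ) *
      (PowerSeries.rescale (-t) (PowerSeries.exp ℂ) * f) = f := by
    rw [← mul_assoc, rescale_exp_mul_rescale_exp_neg, one_mul]
  change fibreSeries p ι (expPair t (pairOperator β γ (expPair (-t) Φ))) = _
  simp only [fibreSeries_expPair hι, fibreSeries_number hι, fibreSeries_annihilation hι,
    fibreSeries_creation hι, pairOperator, LinearMap.add_apply, LinearMap.sub_apply,
    LinearMap.smul_apply, Module.End.one_apply, map_add, map_sub, map_smul,
    Derivation.map_smul, derivative_rescale_exp_mul, mul_add, mul_smul_comm,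
    mul_left_comm PowerSeries.X, cancel]
  module

theorem transformedHamiltonian_eq_pairOperator {y α : ℝ} (h : 1 - 2 * α * y ≠ 0) :
    transformedHamiltonian y α = pairOperator (y₁ y α) (y₂ y α) := by
  have h' : (1 - 2 * α * y : ℂ) ≠ 0 := mod_cast h
  rw [transformedHamiltonian, hamiltonian_eq_pairOperator, expPair_conj_pairOperator, pairOperator,
    y₁, y₂]
  push_cast
  match_scalars <;> field_simp
  ring

theorem isEigenstate_realize_iff {T : Module.End ℂ Formal} {E : ℂ} {Ψ : Fock} :
    IsEigenstate (realize T) E Ψ ↔ Ψ ≠ 0 ∧ T (Ψ : Formal) = E • (Ψ : Formal) := by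
  refine and_congr_right fun _ => ⟨fun ⟨_, h⟩ => congrArg Subtype.val h, fun h => ?_⟩
  have hdomain : Memℓp (T (Ψ : Formal)) 2 := h ▸ lp.memℓp (E • Ψ)
  exact ⟨hdomain, Subtype.ext h⟩

/-- The recurrence for the rescaled coefficients of a formal eigenvector of `pairOperator β γ` along
a fibre. The truncated `C (s - 1)` is multiplied by `s = 0`. -/
def IsFibreSolution (β γ : ℂ) (p : ℕ) (E : ℂ) (C : ℕ → ℂ) : Prop :=
  ∀ s : ℕ, ((p : ℂ) / 2 + s - E) * C s + γ * (s * C (s - 1)) + β * ((p + s + 1) * C (s + 1)) = 0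

theorem IsFibreSolution.eq_zero {β γ : ℂ} (hβ : β ≠ 0) {p : ℕ} {E : ℂ} {C : ℕ → ℂ}
    (h : IsFibreSolution β γ p E C) (h0 : C 0 = 0) : C = 0 := by
  funext s
  induction s using Nat.twoStepInduction with
  | zero => exact h0
  | one => simpa [h0, hβ, Nat.cast_add_one_ne_zero] using h 0
  | more s ih ih' =>
    have hp : (p : ℂ) + (s + 1 : ℕ) + 1 ≠ 0 := mod_cast (p + (s + 1)).succ_ne_zero
    simpa [ih, ih', hβ, -Nat.cast_add, hp] using h (s + 1)

theorem rescaledCoeff_eq (p : ℕ) (ι : ℕ → ℕ × ℕ) (Ψ : Fock) (s : ℕ) :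
    rescaledCoeff p ι Ψ s = s ! * PowerSeries.coeff s (fibreSeries p ι Ψ) := by
  have hs := ofReal_sqrt_mul_self (Nat.cast_nonneg (α := ℝ) s !)
  rw [rescaledCoeff, coeff_fibreSeries, fibreNorm, Real.sqrt_div (by positivity)]
  push_cast at hs ⊢
  rw [← hs]
  field_simp [Nat.factorial_ne_zero]

theorem fibreSeries_pairOperator_eq_smul_iff {β γ : ℂ} {p : ℕ} {ι : ℕ → ℕ × ℕ}
    (hι : ι = fibrePos p ∨ ι = fibreNeg p) {E : ℂ} {Ψ : Fock} :
    fibreSeries p ι (pairOperator β γ Ψ) = E • fibreSeries p ι Ψ ↔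
      IsFibreSolution β γ p E (rescaledCoeff p ι Ψ) := by
  rw [PowerSeries.ext_iff, IsFibreSolution]
  refine forall_congr' fun s => ?_
  have hs : (s ! : ℂ) ≠ 0 := mod_cast s.factorial_ne_zero
  simp only [pairOperator, LinearMap.add_apply, LinearMap.smul_apply, map_add, map_smul,
    fibreSeries_number hι, fibreSeries_annihilation hι, fibreSeries_creation hι, rescaledCoeff_eq,
    map_nsmul]
  rw [← sub_eq_zero, ← mul_right_inj' hs, mul_zero]
  refine Eq.congr ?_ rfl
  rcases s with - | s
  · simp only [PowerSeries.coeff_zero_X_mul, PowerSeries.coeff_derivative, nsmul_eq_mul,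
      smul_eq_mul]
    push_cast
    ring
  · simp only [PowerSeries.coeff_succ_X_mul, PowerSeries.coeff_derivative, Nat.factorial_succ,
      Nat.add_sub_cancel, nsmul_eq_mul, smul_eq_mul]
    push_cast
    ring

theorem isEigenstate_pairOperator_iff {β γ : ℂ} {E : ℂ} {Ψ : Fock} :
    IsEigenstate (realize (pairOperator β γ)) E Ψ ↔ Ψ ≠ 0 ∧
      ∀ p ι, (ι = fibrePos p ∨ ι = fibreNeg p) →
        IsFibreSolution β γ p E (rescaledCoeff p ι Ψ) := by
  rw [isEigenstate_realize_iff]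
  refine and_congr_right fun _ => ⟨fun h p ι hι => ?_, fun h => ext_fibreSeries fun p ι hι => ?_⟩
  · rw [← fibreSeries_pairOperator_eq_smul_iff hι, h, map_smul]
  · rw [(fibreSeries_pairOperator_eq_smul_iff hι).2 (h p ι hι), map_smul]

theorem norm_rescaledCoeff_le (p : ℕ) (ι : ℕ → ℕ × ℕ) (Ψ : Fock) (s : ℕ) :
    ‖rescaledCoeff p ι Ψ s‖ ≤ ‖Ψ‖ := by
  have hweight : √((s ! : ℝ) / (p + s)!) ≤ 1 := by
    rw [Real.sqrt_le_one, div_le_one (by positivity)]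
    exact_mod_cast Nat.factorial_le (Nat.le_add_left s p)
  calc ‖rescaledCoeff p ι Ψ s‖ = √((s ! : ℝ) / (p + s)!) * ‖Ψ (ι s)‖ := by
        rw [rescaledCoeff, norm_mul, Complex.norm_of_nonneg (Real.sqrt_nonneg _)]
    _ ≤ 1 * ‖Ψ‖ := by
        gcongr
        exact lp.norm_apply_le_norm two_ne_zero Ψ (ι s)
    _ = ‖Ψ‖ := one_mul _

theorem rescaledCoeff_eq_zero_iff {p : ℕ} {ι : ℕ → ℕ × ℕ} {Ψ : Fock} {s : ℕ} :
    rescaledCoeff p ι Ψ s = 0 ↔ Ψ (ι s) = 0 := by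
  have hweight : (√((s ! : ℝ) / (p + s)!) : ℂ) ≠ 0 := Complex.ofReal_ne_zero.2 (by positivity)
  rw [rescaledCoeff, mul_eq_zero, or_iff_right hweight]

theorem rescaledCoeff_zero_ne_zero {β γ : ℂ} (hβ : β ≠ 0) {p : ℕ} {ι : ℕ → ℕ × ℕ} {E : ℂ} {Ψ : Fock}
    (h : IsFibreSolution β γ p E (rescaledCoeff p ι Ψ)) {s : ℕ} (hs : Ψ (ι s) ≠ 0) :
    rescaledCoeff p ι Ψ 0 ≠ 0 := fun h0 =>
  hs (rescaledCoeff_eq_zero_iff.1 (congrFun (h.eq_zero hβ h0) s))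

/-! ### Analytic solutions of the first-order equation -/

/-- The first-order operator
`F ↦ (z - a) (z - b) F' - (B (z - b) + (ν - B) (z - a)) F`, whose kernel is spanned by
`(z - a) ^ B (z - b) ^ (ν - B)`. -/
noncomputable def fuchsOp (a b B ν : ℂ) (F : ℂ → ℂ) (z : ℂ) : ℂ :=
  (z - a) * (z - b) * deriv F z - (B * (z - b) + (ν - B) * (z - a)) * F z

theorem fuchsOp_apply_left (a b B ν : ℂ) (F : ℂ → ℂ) :
    fuchsOp a b B ν F a = -(B * (a - b)) * F a := by
  simp [fuchsOp]

theorem analyticAt_iteratedDeriv {F : ℂ → ℂ} {z : ℂ} (hF : AnalyticAt ℂ F z) (m : ℕ) :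
    AnalyticAt ℂ (iteratedDeriv m F) z := by
  rw [iteratedDeriv_eq_iterate]
  exact hF.iterated_deriv m

theorem deriv_fuchsOp {a b B ν z : ℂ} {F : ℂ → ℂ} (hF : AnalyticAt ℂ F z) :
    deriv (fuchsOp a b B ν F) z = fuchsOp a b (B - 1) (ν - 2) (deriv F) z - ν * F z := by
  have hsub (c : ℂ) : HasDerivAt (fun z => z - c) 1 z := (hasDerivAt_id z).sub_const c
  have h := (((hsub a).mul (hsub b)).mul hF.deriv.differentiableAt.hasDerivAt).sub
    ((((hsub b).const_mul B).add ((hsub a).const_mul (ν - B))).mul hF.differentiableAt.hasDerivAt)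
  refine h.deriv.trans ?_
  simp only [fuchsOp, Pi.mul_apply, Pi.add_apply]
  ring

theorem iteratedDeriv_fuchsOp {a b B ν z : ℂ} {F : ℂ → ℂ} (hF : AnalyticAt ℂ F z) (m : ℕ) :
    iteratedDeriv m (fuchsOp a b B ν F) z =
      fuchsOp a b (B - m) (ν - 2 * m) (iteratedDeriv m F) z +
        m * (m - 1 - ν) * iteratedDeriv (m - 1) F z := by
  induction m generalizing z with
  | zero => simp
  | succ m ih =>
    have hD (k : ℕ) := analyticAt_iteratedDeriv hF k
    have hfuchs : AnalyticAt ℂ (fuchsOp a b (B - m) (ν - 2 * m) (iteratedDeriv m F)) z := by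
      have := (hD m).deriv
      unfold fuchsOp
      fun_prop
    have hprev : m * deriv (iteratedDeriv (m - 1) F) z = m * iteratedDeriv m F z := by
      rcases m with - | m
      · simp
      · rw [Nat.add_sub_cancel, ← iteratedDeriv_succ]
    rw [iteratedDeriv_succ, EventuallyEq.deriv_eq (hF.eventually_analyticAt.mono fun _ hw => ih hw),
      deriv_fun_add hfuchs.differentiableAt ((hD _).differentiableAt.const_mul _),
      deriv_const_mul _ (hD _).differentiableAt, deriv_fuchsOp (hD m), ← iteratedDeriv_succ,
      mul_right_comm, hprev]
    simp only [fuchsOp, Nat.add_sub_cancel]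
    push_cast
    ring

theorem exists_natCast_eq_of_fuchsOp_eq_zero {U : Set ℂ} (hU : IsOpen U) (hU' : IsPreconnected U)
    {a b B ν : ℂ} (hab : a ≠ b) (ha : a ∈ U) {F : ℂ → ℂ} (hF : AnalyticOnNhd ℂ F U)
    (hode : ∀ z ∈ U, fuchsOp a b B ν F z = 0) {z₀ : ℂ} (hz₀ : z₀ ∈ U) (hne : F z₀ ≠ 0) :
    ∃ k : ℕ, B = k := by
  by_contra! hB
  -- The `k`-th derivative of the equation at `a` is `(B - k) (a - b) F⁽ᵏ⁾ a = c F⁽ᵏ⁻¹⁾ a`.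
  have hderiv_a (k : ℕ) : iteratedDeriv k F a = 0 := by
    have hrec (k : ℕ) := iteratedDeriv_fuchsOp (a := a) (b := b) (B := B) (ν := ν) (hF a ha) k
    have hzero : fuchsOp a b B ν F =ᶠ[𝓝 a] fun _ => 0 := (hU.eventually_mem ha).mono hode
    simp only [hzero.iteratedDeriv_eq, fuchsOp_apply_left, iteratedDeriv_const, ite_self] at hrec
    have hne (k : ℕ) : -((B - k) * (a - b)) ≠ 0 :=
      neg_ne_zero.2 (mul_ne_zero (sub_ne_zero.2 (hB k)) (sub_ne_zero.2 hab))
    induction k with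
    | zero =>
      refine (mul_eq_zero.1 ?_).resolve_left (hne 0)
      simpa only [Nat.cast_zero, zero_mul, add_zero] using (hrec 0).symm
    | succ k ih =>
      refine (mul_eq_zero.1 ?_).resolve_left (hne (k + 1))
      simpa only [Nat.add_sub_cancel, ih, mul_zero, add_zero] using (hrec (k + 1)).symm
  have horder : analyticOrderAt F a = ⊤ := ENat.eq_top_iff_forall_ge.2 fun n =>
    (natCast_le_analyticOrderAt_iff_iteratedDeriv_eq_zero (hF a ha)).2 fun i _ => hderiv_a i
  exact hne (hF.eqOn_zero_of_preconnected_of_eventuallyEq_zero hU' ha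
    (analyticOrderAt_eq_top.1 horder) hz₀)

/-- The choice `ν = p - 1` makes the lower-order term of `iteratedDeriv_fuchsOp` vanish at the order
`p`, which also kills the right-hand side. -/
theorem fuchsOp_iteratedDeriv_eq_zero {U : Set ℂ} (hU : IsOpen U) {a b B K : ℂ} {p : ℕ} {F : ℂ → ℂ}
    (hF : AnalyticOnNhd ℂ F U)
    (hode : ∀ z ∈ U, fuchsOp a b B (p - 1) F z = K * p * z ^ (p - 1)) {z : ℂ} (hz : z ∈ U) :
    fuchsOp a b (B - p) (-p - 1) (iteratedDeriv p F) z = 0 := by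
  have hrhs : iteratedDeriv p (fun w : ℂ => K * p * w ^ (p - 1)) z = 0 := by
    rw [iteratedDeriv_const_mul_field]
    rcases p with - | p <;> simp
  have h := iteratedDeriv_fuchsOp (a := a) (b := b) (B := B) (ν := p - 1) (hF z hz) p
  rw [EventuallyEq.iteratedDeriv_eq p ((hU.eventually_mem hz).mono hode), hrhs] at h
  rw [show (-p - 1 : ℂ) = p - 1 - 2 * p by ring]
  simpa using h.symm

theorem iteratedDeriv_zero_of_fuchsOp_eq {a b B ν K : ℂ} (ha : a ≠ 0) (hb : b ≠ 0) {n : ℕ}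
    {F : ℂ → ℂ} (hF : AnalyticAt ℂ F 0) (hF0 : F 0 = 0)
    (hode : ∀ᶠ z in 𝓝 0, fuchsOp a b B ν F z = K * z ^ n) :
    (∀ m ≤ n, iteratedDeriv m F 0 = 0) ∧ a * b * iteratedDeriv (n + 1) F 0 = K * n ! := by
  have hrec {m : ℕ} (h : iteratedDeriv m F 0 = 0) (h' : iteratedDeriv (m - 1) F 0 = 0) :
      a * b * iteratedDeriv (m + 1) F 0 = K * if m = n then (n ! : ℂ) else 0 := by
    have hm := iteratedDeriv_fuchsOp (a := a) (b := b) (B := B) (ν := ν) hF m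
    rw [EventuallyEq.iteratedDeriv_eq m hode, iteratedDeriv_const_mul_field,
      iteratedDeriv_fun_pow_zero, h'] at hm
    simpa [fuchsOp, h, iteratedDeriv_succ] using hm.symm
  have hzero (m : ℕ) (hm : m ≤ n) : iteratedDeriv m F 0 = 0 ∧ iteratedDeriv (m - 1) F 0 = 0 := by
    induction m with
    | zero => simp [hF0]
    | succ m ih =>
      obtain ⟨h, h'⟩ := ih (Nat.le_of_succ_le hm)
      simpa [h, ha, hb, (Nat.lt_of_succ_le hm).ne] using hrec h h'
  exact ⟨fun m hm => (hzero m hm).1, by simpa using hrec (hzero n le_rfl).1 (hzero n le_rfl).2⟩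

theorem exists_eq_add_natCast_of_iteratedDeriv_ne_zero {U : Set ℂ} (hU : IsOpen U)
    (hU' : IsPreconnected U) {a b B K : ℂ} (hab : a ≠ b) (ha : a ∈ U) {p : ℕ} {F : ℂ → ℂ}
    (hF : AnalyticOnNhd ℂ F U)
    (hode : ∀ z ∈ U, fuchsOp a b B (p - 1) F z = K * p * z ^ (p - 1)) {z₀ : ℂ} (hz₀ : z₀ ∈ U)
    (hne : iteratedDeriv p F z₀ ≠ 0) : ∃ k : ℕ, B = p + k := by
  obtain ⟨k, hk⟩ := exists_natCast_eq_of_fuchsOp_eq_zero hU hU' hab ha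
    (fun z hz => analyticAt_iteratedDeriv (hF z hz) p)
    (fun z hz => fuchsOp_iteratedDeriv_eq_zero hU hF hode hz) hz₀ hne
  exact ⟨k, by rw [← hk, add_sub_cancel]⟩

theorem exists_eq_add_natCast_of_fuchsOp_eq {U : Set ℂ} (hU : IsOpen U) (hU' : IsPreconnected U)
    {a b B K : ℂ} (hab : a ≠ b) (ha : a ∈ U) {p : ℕ} {F : ℂ → ℂ} (hF : AnalyticOnNhd ℂ F U)
    (hode : ∀ z ∈ U, fuchsOp a b B (p - 1) F z = K * p * z ^ (p - 1)) (h0 : 0 ∈ U) (ha0 : a ≠ 0)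
    (hb0 : b ≠ 0) (hp : 0 < p) (hK : K ≠ 0) (hF0 : F 0 = 0) : ∃ k : ℕ, B = p + k := by
  refine exists_eq_add_natCast_of_iteratedDeriv_ne_zero hU hU' hab ha hF hode h0 fun h => ?_
  have hcoeff := (iteratedDeriv_zero_of_fuchsOp_eq ha0 hb0 (hF 0 h0) hF0
    ((hU.eventually_mem h0).mono hode)).2
  rw [Nat.sub_add_cancel hp, h, mul_zero] at hcoeff
  simp [hK, hp.ne', Nat.factorial_ne_zero] at hcoeff

/-! ### Generating functions of eigenvectors -/

/-- The generating function `∑ C_s z ^ (p + s)` of the coefficients along a fibre. The factor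
`z ^ p` turns the recurrence for the coefficients into a first-order differential equation without
a term in `1 / z`. -/
noncomputable def genSeries (p : ℕ) (C : ℕ → ℂ) (z : ℂ) : ℂ := ∑' s, C s * z ^ (p + s)

section GenSeries

variable {C : ℕ → ℂ} {M : ℝ}

theorem norm_mul_pow_le (hC : ∀ s, ‖C s‖ ≤ M) (p : ℕ) {r : ℝ} (hr : r ≤ 1) {z : ℂ}
    (hz : ‖z‖ ≤ r) (s : ℕ) : ‖C s * z ^ (p + s)‖ ≤ M * r ^ s := by
  rw [norm_mul, norm_pow]
  have hM : 0 ≤ M := (norm_nonneg _).trans (hC 0)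
  calc ‖C s‖ * ‖z‖ ^ (p + s) ≤ M * ‖z‖ ^ s := by
        have := pow_le_pow_of_le_one (norm_nonneg z) (hz.trans hr) (Nat.le_add_left s p)
        exact mul_le_mul (hC s) this (by positivity) hM
    _ ≤ M * r ^ s := by gcongr

theorem hasSum_genSeries (hC : ∀ s, ‖C s‖ ≤ M) (p : ℕ) {z : ℂ} (hz : ‖z‖ < 1) :
    HasSum (fun s => C s * z ^ (p + s)) (genSeries p C z) :=
  (Summable.of_norm_bounded ((summable_geometric_of_lt_one (norm_nonneg z) hz).mul_left M)
    (norm_mul_pow_le hC p hz.le le_rfl)).hasSum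

theorem analyticOnNhd_genSeries (hC : ∀ s, ‖C s‖ ≤ M) (p : ℕ) :
    AnalyticOnNhd ℂ (genSeries p C) (ball 0 1) := by
  intro z hz
  obtain ⟨r, hzr, hr⟩ := exists_between (mem_ball_zero_iff.1 hz)
  have hr0 : 0 ≤ r := (norm_nonneg z).trans hzr.le
  refine (Complex.differentiableOn_tsum_of_summable_norm
    ((summable_geometric_of_lt_one hr0 hr).mul_left M) (fun s => by fun_prop) isOpen_ball
    fun s w hw => norm_mul_pow_le hC p hr.le (mem_ball_zero_iff.1 hw).le s).analyticOnNhd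
    isOpen_ball z (mem_ball_zero_iff.2 hzr)

theorem hasSum_deriv_genSeries (hC : ∀ s, ‖C s‖ ≤ M) (p : ℕ) {z : ℂ} (hz : ‖z‖ < 1) :
    HasSum (fun s => C s * ((p + s : ℕ) * z ^ (p + s - 1))) (deriv (genSeries p C) z) := by
  obtain ⟨r, hzr, hr⟩ := exists_between hz
  have hr0 : 0 ≤ r := (norm_nonneg z).trans hzr.le
  refine (Complex.hasSum_deriv_of_summable_norm
    ((summable_geometric_of_lt_one hr0 hr).mul_left M) (fun s => by fun_prop) isOpen_ball
    (fun s w hw => norm_mul_pow_le hC p hr.le (mem_ball_zero_iff.1 hw).le s)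
    (mem_ball_zero_iff.2 hzr)).congr_fun fun s => ?_
  simp

theorem genSeries_zero_left_apply_zero (C : ℕ → ℂ) : genSeries 0 C 0 = C 0 := by
  rw [genSeries, tsum_eq_single 0 fun s hs => by simp [hs]]
  simp

theorem genSeries_apply_zero {p : ℕ} (hp : 0 < p) (C : ℕ → ℂ) : genSeries p C 0 = 0 := by
  have hterm (s : ℕ) : C s * 0 ^ (p + s) = 0 := by rw [zero_pow (by lia), mul_zero]
  simp only [genSeries, hterm, tsum_zero]

theorem hasSum_mul_deriv_genSeries (hC : ∀ s, ‖C s‖ ≤ M) (p : ℕ) {z : ℂ} (hz : ‖z‖ < 1) :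
    HasSum (fun s => (p + s) * C s * z ^ (p + s)) (z * deriv (genSeries p C) z) := by
  refine ((hasSum_deriv_genSeries hC p hz).mul_left z).congr_fun fun s => ?_
  rw [← Nat.cast_add]
  rcases p + s with - | n
  · simp
  · rw [Nat.add_sub_cancel, pow_succ]
    ring

theorem IsFibreSolution.genSeries_ode {β γ : ℂ} {p : ℕ} {E : ℂ} (h : IsFibreSolution β γ p E C)
    (hC : ∀ s, ‖C s‖ ≤ M) {z : ℂ} (hz : ‖z‖ < 1) :
    (γ * z ^ 2 + z + β) * deriv (genSeries p C) z -
        (p / 2 + E + γ * (p - 1) * z) * genSeries p C z =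
      β * C 0 * p * z ^ (p - 1) := by
  have hF := hasSum_genSeries hC p hz
  have hzF' := hasSum_mul_deriv_genSeries hC p hz
  have hdiag : HasSum (fun s => (p / 2 + s - E) * C s * z ^ (p + s))
      (z * deriv (genSeries p C) z - (p / 2 + E) * genSeries p C z) :=
    (hzF'.sub (hF.mul_left (p / 2 + E))).congr_fun fun s => by ring
  have hlower : HasSum (fun s : ℕ => s * C (s - 1) * z ^ (p + s))
      (z * (z * deriv (genSeries p C) z - (p - 1) * genSeries p C z)) := by
    rw [← hasSum_nat_add_iff' 1]
    simp only [Finset.range_one, Finset.sum_singleton, Nat.cast_zero, zero_mul, sub_zero]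
    refine ((hzF'.sub (hF.mul_left ((p : ℂ) - 1))).mul_left z).congr_fun fun s => ?_
    rw [Nat.add_sub_cancel]
    push_cast
    ring
  have hupper : HasSum (fun s : ℕ => (p + s + 1) * C (s + 1) * z ^ (p + s))
      (deriv (genSeries p C) z - C 0 * (p * z ^ (p - 1))) := by
    have h := (hasSum_nat_add_iff' 1).2 (hasSum_deriv_genSeries hC p hz)
    simp only [Finset.range_one, Finset.sum_singleton, add_zero] at h
    refine h.congr_fun fun s => ?_
    rw [← add_assoc, Nat.add_sub_cancel]
    push_cast
    ring
  have hsum := (hdiag.add (hlower.mul_left γ)).add (hupper.mul_left β)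
  have hzero := hsum.unique (hasSum_zero.congr_fun fun s => by linear_combination z ^ (p + s) * h s)
  linear_combination hzero

end GenSeries

/-- `-1 < a < 0` and `b < -1` are the roots of `γ z ^ 2 + z + β`, the leading coefficient of the
differential equation for the generating functions. -/
structure IsRootPair (β γ a b : ℝ) : Prop where
  pos : 0 < γ
  sum : γ * (a + b) = -1
  prod : γ * (a * b) = β
  neg_one_lt : -1 < a
  neg : a < 0
  lt_neg_one : b < -1

/-- The exponent at the root `a` of the differential equation for the generating functions of
eigenvectors with eigenvalue `E`. -/
noncomputable def rootExponent (γ a b : ℝ) (p : ℕ) (E : ℂ) : ℂ :=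
  (p / 2 + E + γ * (p - 1) * a) / (γ * (a - b))

namespace IsRootPair

variable {β γ a b : ℝ} (hr : IsRootPair β γ a b)
include hr

theorem β_pos : 0 < β := by
  rw [← hr.prod]
  have := hr.lt_neg_one
  exact mul_pos hr.pos (mul_pos_of_neg_of_neg hr.neg (by linarith))

theorem lt : b < a := hr.lt_neg_one.trans hr.neg_one_lt

theorem gap_pos : 0 < γ * (a - b) := mul_pos hr.pos (sub_pos.2 hr.lt)

theorem mem_ball : (a : ℂ) ∈ ball (0 : ℂ) 1 := by
  rw [mem_ball_zero_iff, Complex.norm_real, Real.norm_eq_abs, abs_lt]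
  exact ⟨hr.neg_one_lt, hr.neg.trans one_pos⟩

theorem ofReal_ne : (a : ℂ) ≠ b := Complex.ofReal_injective.ne hr.lt.ne'

theorem factor (z : ℂ) : (γ : ℂ) * z ^ 2 + z + β = γ * ((z - a) * (z - b)) := by
  have hsum : (γ : ℂ) * (a + b) = -1 := mod_cast hr.sum
  have hprod : (γ : ℂ) * (a * b) = β := mod_cast hr.prod
  linear_combination z * hsum - hprod

theorem fuchsOp_genSeries {p : ℕ} {E : ℂ} {C : ℕ → ℂ} (h : IsFibreSolution β γ p E C) {M : ℝ}
    (hC : ∀ s, ‖C s‖ ≤ M) {z : ℂ} (hz : z ∈ ball (0 : ℂ) 1) :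
    fuchsOp a b (rootExponent γ a b p E) (p - 1) (genSeries p C) z =
      C 0 * β / γ * p * z ^ (p - 1) := by
  have hγ : (γ : ℂ) ≠ 0 := mod_cast hr.pos.ne'
  have hgap : (γ * (a - b) : ℂ) ≠ 0 := mod_cast hr.gap_pos.ne'
  have hB : rootExponent γ a b p E * (γ * (a - b)) = p / 2 + E + γ * (p - 1) * a :=
    div_mul_cancel₀ _ hgap
  have hode := h.genSeries_ode hC (mem_ball_zero_iff.1 hz)
  rw [hr.factor z] at hode
  rw [fuchsOp]
  field_simp
  linear_combination hode - genSeries p C z * hB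

theorem exists_energy_eq {p : ℕ} {E : ℂ} {C : ℕ → ℂ} (h : IsFibreSolution β γ p E C) {M : ℝ}
    (hC : ∀ s, ‖C s‖ ≤ M) (h0 : C 0 ≠ 0) :
    ∃ k : ℕ, E = ((γ * (a - b) - 1) / 2 + γ * (a - b) / 2 * (p + 2 * k : ℕ) : ℂ) := by
  have hF := analyticOnNhd_genSeries hC p
  have hode := fun z (hz : z ∈ ball (0 : ℂ) 1) => hr.fuchsOp_genSeries h hC hz
  have hball := (convex_ball (0 : ℂ) 1).isPreconnected
  have h0ball : (0 : ℂ) ∈ ball (0 : ℂ) 1 := mem_ball_self one_pos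
  obtain ⟨k, hk⟩ : ∃ k : ℕ, rootExponent γ a b p E = p + k := by
    rcases p.eq_zero_or_pos with rfl | hp
    · refine exists_eq_add_natCast_of_iteratedDeriv_ne_zero isOpen_ball hball hr.ofReal_ne
        hr.mem_ball hF hode h0ball ?_
      rwa [iteratedDeriv_zero, genSeries_zero_left_apply_zero]
    · have hβ : (β : ℂ) ≠ 0 := mod_cast hr.β_pos.ne'
      have hγ : (γ : ℂ) ≠ 0 := mod_cast hr.pos.ne'
      have ha : (a : ℂ) ≠ 0 := mod_cast hr.neg.ne
      have hb : (b : ℂ) ≠ 0 := mod_cast (hr.lt.trans hr.neg).ne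
      exact exists_eq_add_natCast_of_fuchsOp_eq isOpen_ball hball hr.ofReal_ne hr.mem_ball hF hode
        h0ball ha hb hp (div_ne_zero (mul_ne_zero h0 hβ) hγ) (genSeries_apply_zero hp C)
  have hgap : (γ * (a - b) : ℂ) ≠ 0 := mod_cast hr.gap_pos.ne'
  have hsum : (γ : ℂ) * (a + b) = -1 := mod_cast hr.sum
  rw [rootExponent, div_eq_iff hgap] at hk
  refine ⟨k, ?_⟩
  push_cast
  linear_combination hk - (p - 1) / 2 * hsum

end IsRootPair

/-! ### The integral formula -/

/-- The integrand of `rootIntegral`, with principal branches. -/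
noncomputable def rootKernel (a b : ℝ) (p : ℕ) (B z : ℂ) : ℂ :=
  z ^ (p - 1) * (z - a) ^ (-(1 + B)) * (z - b) ^ (-(1 + ((p : ℂ) - 1 - B)))

/-- `integralFormula` with `a`, `b` and `K` in place of `z₊`, `z₋` and `C₀ y₁ / y₂`: the solution by
variation of constants of `fuchsOp a b B (p - 1) F = K p z ^ (p - 1)` with `F 0 = 0`. -/
noncomputable def rootIntegral (a b : ℝ) (p : ℕ) (K B z : ℂ) : ℂ :=
  K * p * (z - a) ^ B * (z - b) ^ ((p : ℂ) - 1 - B) *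
    ∫ t in (0 : ℝ)..1, rootKernel a b p B (t * z) * z

/-- `slitDisk` with `a` in place of `z₊`. -/
def slitBall (a : ℝ) : Set ℂ := {z | ‖z‖ < 1 ∧ z ≠ 0 ∧ z - a ∈ Complex.slitPlane}

section RootIntegral

open Complex (slitPlane)

theorem cpow_sub_one_mul_self {z : ℂ} (hz : z ≠ 0) (D : ℂ) : z ^ (D - 1) * z = z ^ D := by
  rw [Complex.cpow_sub _ _ hz, Complex.cpow_one, div_mul_cancel₀ _ hz]

theorem hasDerivAt_mul_cpow_mul_cpow {a b B C F' z : ℂ} {F : ℂ → ℂ} (hF : HasDerivAt F F' z)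
    (ha : z - a ∈ slitPlane) (hb : z - b ∈ slitPlane) :
    HasDerivAt (fun z => F z * (z - a) ^ B * (z - b) ^ C)
      (((z - a) * (z - b) * F' + (B * (z - b) + C * (z - a)) * F z) *
        (z - a) ^ (B - 1) * (z - b) ^ (C - 1)) z := by
  have hderiv {c : ℂ} (D : ℂ) (hc : z - c ∈ slitPlane) :=
    ((hasDerivAt_id z).sub_const c).cpow_const (c := D) hc
  refine ((hF.fun_mul (hderiv B ha)).fun_mul (hderiv C hb)).congr_deriv ?_
  simp only [id, ← cpow_sub_one_mul_self (Complex.slitPlane_ne_zero ha) B,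
    ← cpow_sub_one_mul_self (Complex.slitPlane_ne_zero hb) C]
  ring

theorem starConvex_setOf_sub_mem_slitPlane {a : ℝ} (ha : a < 0) :
    StarConvex ℝ 0 {z : ℂ | z - a ∈ slitPlane} := by
  intro z hz s t hs ht hst
  have h := Complex.starConvex_ofReal_slitPlane (neg_pos.2 ha) hz hs ht hst
  have hst' : (s : ℂ) + t = 1 := mod_cast hst
  refine mem_ofPred.2 (Eq.mp (congrArg (· ∈ slitPlane) ?_) h)
  simp only [Complex.real_smul, Complex.ofReal_neg]
  linear_combination -(a : ℂ) * hst'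

theorem sub_mem_slitPlane_of_norm_lt {a : ℝ} {z : ℂ} (hz : ‖z‖ < -a) : z - a ∈ slitPlane := by
  have hre := (abs_le.1 (Complex.abs_re_le_norm z)).1
  refine Complex.mem_slitPlane_iff.2 (.inl ?_)
  rw [Complex.sub_re, Complex.ofReal_re]
  linarith

theorem integral_segment_eq_sub {f P : ℂ → ℂ} {z : ℂ}
    (hf : ∀ t ∈ Icc (0 : ℝ) 1, ContinuousAt f (t * z))
    (hP : ∀ t ∈ Icc (0 : ℝ) 1, HasDerivAt P (f (t * z)) (t * z)) :
    ∫ t in (0 : ℝ)..1, f (t * z) * z = P z - P 0 := by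
  have hcont : ContinuousOn (fun t : ℝ => f (0 + t • z)) (Icc 0 1) := fun t ht => by
    simp only [zero_add, Complex.real_smul]
    exact (ContinuousAt.comp (f := fun t : ℝ => (t * z : ℂ)) (hf t ht)
      (by fun_prop)).continuousWithinAt
  have h := intervalIntegral.integral_unitInterval_deriv_eq_sub (f := P) hcont fun t ht => by
    simpa using hP t ht
  simpa [mul_comm z] using h

variable {a b : ℝ} {p : ℕ} {K B : ℂ}

theorem differentiableAt_rootKernel {z : ℂ} (ha : z - a ∈ slitPlane) (hb : z - b ∈ slitPlane) :
    DifferentiableAt ℂ (rootKernel a b p B) z := by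
  unfold rootKernel
  fun_prop (disch := assumption)

theorem eq_rootIntegral_of_fuchsOp_eq (ha : a < 0) (hb : b < 0) {U : Set ℂ} (hU : IsOpen U)
    (hU' : StarConvex ℝ 0 U) {F : ℂ → ℂ} (hF : DifferentiableOn ℂ F U) (hF0 : F 0 = 0)
    (hode : ∀ z ∈ U, fuchsOp a b B (p - 1) F z = K * p * z ^ (p - 1)) {z : ℂ} (hz : z ∈ U)
    (hza : z - a ∈ slitPlane) (hzb : z - b ∈ slitPlane) : F z = rootIntegral a b p K B z := by
  set C : ℂ := p - 1 - B with hC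
  have hderiv (t : ℝ) (ht : t ∈ Icc (0 : ℝ) 1) :
      HasDerivAt (fun u => F u * (u - a) ^ (-B) * (u - b) ^ (-C))
        (K * p * rootKernel a b p B (t * z)) (t * z) := by
    have htz : (t * z : ℂ) ∈ U := hU'.smul_mem hz ht.1 ht.2
    have hd := (hF.differentiableAt (hU.mem_nhds htz)).hasDerivAt
    refine (hasDerivAt_mul_cpow_mul_cpow hd
      ((starConvex_setOf_sub_mem_slitPlane ha).smul_mem hza ht.1 ht.2)
      ((starConvex_setOf_sub_mem_slitPlane hb).smul_mem hzb ht.1 ht.2)).congr_deriv ?_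
    have h := hode _ htz
    rw [fuchsOp] at h
    rw [neg_sub_left, neg_sub_left, rootKernel, ← hC]
    linear_combination (t * z - a : ℂ) ^ (-(1 + B)) * (t * z - b : ℂ) ^ (-(1 + C)) * h
  have hcont (t : ℝ) (ht : t ∈ Icc (0 : ℝ) 1) :
      ContinuousAt (fun u => K * p * rootKernel a b p B u) (t * z) :=
    ((differentiableAt_rootKernel
      ((starConvex_setOf_sub_mem_slitPlane ha).smul_mem hza ht.1 ht.2)
      ((starConvex_setOf_sub_mem_slitPlane hb).smul_mem hzb ht.1 ht.2)).const_mul _).continuousAt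
  have hFTC := integral_segment_eq_sub hcont hderiv
  have hpow {c : ℂ} (D : ℂ) (hc : z - c ∈ slitPlane) : (z - c) ^ D * (z - c) ^ (-D) = 1 := by
    rw [← Complex.cpow_add _ _ (Complex.slitPlane_ne_zero hc), add_neg_cancel, Complex.cpow_zero]
  simp only [mul_assoc (K * p), intervalIntegral.integral_const_mul, hF0, zero_mul,
    sub_zero] at hFTC
  rw [rootIntegral, ← hC]
  linear_combination (-(z - a) ^ B * (z - b) ^ C) * hFTC -
    F z * ((z - b) ^ C * (z - b) ^ (-C)) * hpow B hza - F z * hpow C hzb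

theorem exists_fuchsOp_eq (hba : b ≤ a) (p : ℕ) (K B : ℂ) :
    ∃ S : ℂ → ℂ, DifferentiableOn ℂ S (ball 0 (-a)) ∧ S 0 = 0 ∧
      ∀ z ∈ ball (0 : ℂ) (-a), fuchsOp a b B (p - 1) S z = K * p * z ^ (p - 1) := by
  set C : ℂ := p - 1 - B with hC
  have hslit (z : ℂ) (hz : z ∈ ball (0 : ℂ) (-a)) : z - a ∈ slitPlane ∧ z - b ∈ slitPlane := by
    have hz' := mem_ball_zero_iff.1 hz
    exact ⟨sub_mem_slitPlane_of_norm_lt hz', sub_mem_slitPlane_of_norm_lt (by linarith)⟩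
  have hkernel : DifferentiableOn ℂ (fun z => K * p * rootKernel a b p B z) (ball 0 (-a)) :=
    fun z hz => ((differentiableAt_rootKernel (hslit z hz).1
      (hslit z hz).2).const_mul _).differentiableWithinAt
  obtain ⟨Q, hQ0, hQ⟩ := hkernel.isExactOn_ball.with_val_at 0 0
  have hderiv (z : ℂ) (hz : z ∈ ball (0 : ℂ) (-a)) :=
    hasDerivAt_mul_cpow_mul_cpow (B := B) (C := C) (hQ z hz) (hslit z hz).1 (hslit z hz).2
  refine ⟨_, fun z hz => (hderiv z hz).differentiableAt.differentiableWithinAt, by simp [hQ0],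
    fun z hz => ?_⟩
  have hpow {w : ℂ} (hw : w ∈ slitPlane) (D : ℂ) : w ^ (D - 1) * w ^ (-(1 + D)) * w ^ 2 = 1 := by
    have hw' := Complex.slitPlane_ne_zero hw
    rw [← Complex.cpow_ofNat, ← Complex.cpow_add _ _ hw', ← Complex.cpow_add _ _ hw']
    ring_nf
    exact Complex.cpow_zero w
  obtain ⟨hza, hzb⟩ := hslit z hz
  rw [fuchsOp, (hderiv z hz).deriv, rootKernel, ← hC,
    ← cpow_sub_one_mul_self (Complex.slitPlane_ne_zero hza) B,
    ← cpow_sub_one_mul_self (Complex.slitPlane_ne_zero hzb) C]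
  linear_combination (K * p * z ^ (p - 1)) *
    ((z - b) ^ (C - 1) * (z - b) ^ (-(1 + C)) * (z - b) ^ 2 * hpow hza B + hpow hzb C)

theorem eqOn_rootIntegral_iff (ha : a < 0) (ha' : -1 < a) (hb : b < -1) {F : ℂ → ℂ}
    (hF : AnalyticOnNhd ℂ F (ball 0 1)) :
    EqOn F (rootIntegral a b p K B) (slitBall a) ↔
      F 0 = 0 ∧ ∀ z ∈ ball (0 : ℂ) 1, fuchsOp a b B (p - 1) F z = K * p * z ^ (p - 1) := by
  have hball {r : ℝ} (hr : 0 < r) : StarConvex ℝ 0 (ball (0 : ℂ) r) :=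
    (convex_ball 0 r).starConvex (mem_ball_self hr)
  refine ⟨fun h => ?_, fun ⟨hF0, hode⟩ z ⟨hz, _, hza⟩ =>
    eq_rootIntegral_of_fuchsOp_eq ha (by linarith) isOpen_ball (hball one_pos) hF.differentiableOn
      hF0 hode (mem_ball_zero_iff.2 hz) hza (sub_mem_slitPlane_of_norm_lt (by linarith))⟩
  -- Near `0` the formula is an analytic solution `S`; the identity theorem extends its equation.
  obtain ⟨S, hS, hS0, hSode⟩ := exists_fuchsOp_eq (hb.trans ha').le p K B
  have hnhds : ball (0 : ℂ) (-a) ∈ 𝓝 0 := ball_mem_nhds 0 (neg_pos.2 ha)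
  have hFS : F =ᶠ[𝓝[≠] 0] S := by
    filter_upwards [nhdsWithin_le_nhds hnhds, self_mem_nhdsWithin] with z hz hz0
    have hz' := mem_ball_zero_iff.1 hz
    have hza := sub_mem_slitPlane_of_norm_lt hz'
    exact (h ⟨by linarith, hz0, hza⟩).trans (eq_rootIntegral_of_fuchsOp_eq ha (by linarith)
      isOpen_ball (hball (neg_pos.2 ha)) hS hS0 hSode hz hza
      (sub_mem_slitPlane_of_norm_lt (by linarith))).symm
  have hFS' : F =ᶠ[𝓝 0] S :=
    ((hF 0 (mem_ball_self one_pos)).continuousAt.eventuallyEq_nhds_iff_eventuallyEq_nhdsNE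
      (hS.continuousOn.continuousAt hnhds)).1 hFS
  refine ⟨hFS'.eq_of_nhds.trans hS0, ?_⟩
  have hfuchs : AnalyticOnNhd ℂ (fuchsOp a b B (p - 1) F) (ball 0 1) := fun z hz => by
    have hFz : AnalyticAt ℂ F z := hF z hz
    have : AnalyticAt ℂ (deriv F) z := hFz.deriv
    unfold fuchsOp
    fun_prop
  refine hfuchs.eqOn_of_preconnected_of_eventuallyEq (fun z _ => by fun_prop)
    (convex_ball (0 : ℂ) 1).isPreconnected (mem_ball_self one_pos) ?_
  filter_upwards [hFS'.eventuallyEq_nhds, hnhds] with z hz hzball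
  rw [← hSode z hzball, fuchsOp, fuchsOp, hz.deriv_eq, hz.eq_of_nhds]

end RootIntegral

theorem fuchsOp_sum {ι : Type*} (s : Finset ι) (a b B ν : ℂ) (c : ι → ℂ) {f : ι → ℂ → ℂ} {z : ℂ}
    (hf : ∀ i ∈ s, DifferentiableAt ℂ (f i) z) :
    fuchsOp a b B ν (fun z => ∑ i ∈ s, c i * f i z) z = ∑ i ∈ s, c i * fuchsOp a b B ν (f i) z := by
  have hderiv : deriv (fun z => ∑ i ∈ s, c i * f i z) z = ∑ i ∈ s, c i * deriv (f i) z :=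
    (HasDerivAt.fun_sum fun i hi => (hf i hi).hasDerivAt.const_mul (c i)).deriv
  simp only [fuchsOp, hderiv, Finset.mul_sum, ← Finset.sum_sub_distrib]
  exact Finset.sum_congr rfl fun i _ => by ring

theorem fuchsOp_sub_const_mul {a b B ν c : ℂ} {F G : ℂ → ℂ} {z : ℂ} (hF : DifferentiableAt ℂ F z)
    (hG : DifferentiableAt ℂ G z) :
    fuchsOp a b B ν (fun z => F z - c * G z) z =
      fuchsOp a b B ν F z - c * fuchsOp a b B ν G z := by
  rw [fuchsOp, fuchsOp, fuchsOp, deriv_fun_sub hF (hG.const_mul c), deriv_const_mul c hG]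
  ring

theorem fuchsOp_pow_mul_zpow (a b B : ℂ) {ν : ℂ} {k : ℕ} {l : ℤ} (hν : ν = k + l) {z : ℂ}
    (hz : z ≠ b) :
    fuchsOp a b B ν (fun z => (z - a) ^ k * (z - b) ^ l) z =
      (k - B) * (a - b) * ((z - a) ^ k * (z - b) ^ l) := by
  have hzb : z - b ≠ 0 := sub_ne_zero.2 hz
  have hka : HasDerivAt (fun z : ℂ => (z - a) ^ k) (k * (z - a) ^ (k - 1)) z := by
    simpa using ((hasDerivAt_id z).sub_const a).fun_pow k
  have hlb : HasDerivAt (fun z : ℂ => (z - b) ^ l) (l * (z - b) ^ (l - 1)) z :=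
    (hasDerivAt_zpow l _ (.inl hzb)).comp_sub_const z b
  have hmul_a : (z - a) * (k * (z - a) ^ (k - 1)) = k * (z - a) ^ k := by
    rcases k with - | k
    · simp
    · rw [Nat.add_sub_cancel, pow_succ]
      ring
  have hmul_b : (z - b) * (z - b) ^ (l - 1) = (z - b) ^ l := by
    rw [mul_comm, ← zpow_add_one₀ hzb, sub_add_cancel]
  rw [fuchsOp, (hka.fun_mul hlb).deriv, hν]
  linear_combination (z - b) * (z - b) ^ l * hmul_a + l * (z - a) * (z - a) ^ k * hmul_b

theorem sub_mul_pow_eq_sum (a b z : ℂ) (n : ℕ) :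
    ((a - b) * z) ^ n = ∑ k ∈ Finset.range (n + 1),
      (-b) ^ k * a ^ (n - k) * n.choose k * ((z - a) ^ k * (z - b) ^ (n - k)) := by
  rw [show (a - b) * z = -b * (z - a) + a * (z - b) by ring, add_pow]
  exact Finset.sum_congr rfl fun k _ => by
    rw [mul_pow, mul_pow]
    ring

/-- The polynomials `(z - a) ^ k (z - b) ^ (n - k)` are eigenfunctions of `fuchsOp a b m n` with the
eigenvalues `(k - m) (a - b) ≠ 0`, and they span the polynomials of degree at most `n`. -/
theorem exists_differentiable_fuchsOp_eq {a b : ℂ} (hab : a ≠ b) {n m : ℕ} (hnm : n < m) (K : ℂ) :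
    ∃ F : ℂ → ℂ, Differentiable ℂ F ∧ ∀ z ≠ b, fuchsOp a b m n F z = K * z ^ n := by
  have hab' : a - b ≠ 0 := sub_ne_zero.2 hab
  set q : ℕ → ℂ := fun k => K / (a - b) ^ n * ((-b) ^ k * a ^ (n - k) * n.choose k) with hq
  refine ⟨fun z => ∑ k ∈ Finset.range (n + 1),
    q k / ((k - m) * (a - b)) * ((z - a) ^ k * (z - b) ^ (n - k)), by fun_prop, fun z hz => ?_⟩
  have hterm (k : ℕ) (hk : k ∈ Finset.range (n + 1)) :
      q k / ((k - m) * (a - b)) *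
          fuchsOp a b m n (fun z => (z - a) ^ k * (z - b) ^ (n - k)) z =
        q k * ((z - a) ^ k * (z - b) ^ (n - k)) := by
    have hkn : k ≤ n := Nat.lt_succ_iff.1 (Finset.mem_range.1 hk)
    have hkm : (k - m : ℂ) ≠ 0 := sub_ne_zero.2 (mod_cast (hkn.trans_lt hnm).ne)
    have h := fuchsOp_pow_mul_zpow a b m (ν := n) (k := k) (l := (n - k : ℕ))
      (by push_cast [hkn]; ring) hz
    simp only [zpow_natCast] at h
    rw [h, ← mul_assoc, div_mul_cancel₀ _ (mul_ne_zero hkm hab')]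
  rw [fuchsOp_sum _ _ _ _ _ _ fun k _ => by fun_prop, Finset.sum_congr rfl hterm]
  have hsum := sub_mul_pow_eq_sum a b z n
  simp only [hq, mul_assoc (K / (a - b) ^ n), ← Finset.mul_sum, ← hsum]
  rw [mul_pow]
  field_simp

theorem exists_analyticOnNhd_fuchsOp_eq {U : Set ℂ} (hU : IsOpen U) {a b : ℂ} (ha : a ≠ 0)
    (hb : b ≠ 0) (hab : a ≠ b) (hbU : b ∉ U) {n m : ℕ} (hnm : n < m) (K : ℂ) :
    ∃ F : ℂ → ℂ, AnalyticOnNhd ℂ F U ∧ F 0 = 0 ∧ ∀ z ∈ U, fuchsOp a b m n F z = K * z ^ n := by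
  -- The homogeneous solution `H` has no pole in `U`; a multiple of it corrects the value at `0`.
  obtain ⟨S, hS, hSode⟩ := exists_differentiable_fuchsOp_eq hab hnm K
  set H : ℂ → ℂ := fun z => (z - a) ^ m * (z - b) ^ (n - m : ℤ) with hH
  have hne (z : ℂ) (hz : z ∈ U) : z ≠ b := fun h => hbU (h ▸ hz)
  have hHd (z : ℂ) (hz : z ∈ U) : DifferentiableAt ℂ H z := by
    have hzb : z - b ≠ 0 := sub_ne_zero.2 (hne z hz)
    exact DifferentiableAt.mul (by fun_prop)
      (DifferentiableAt.zpow (by fun_prop) (.inl hzb))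
  have hH0 : H 0 ≠ 0 := by simp [hH, ha, hb, zpow_ne_zero]
  refine ⟨fun z => S z - S 0 / H 0 * H z, ?_, by simp [hH0], fun z hz => ?_⟩
  · exact DifferentiableOn.analyticOnNhd (fun z hz => (hS z).sub
      ((hHd z hz).const_mul _) |>.differentiableWithinAt) hU
  · rw [fuchsOp_sub_const_mul (hS z) (hHd z hz), hSode z (hne z hz),
      fuchsOp_pow_mul_zpow a b m (by push_cast; ring) (hne z hz)]
    ring

theorem exists_analyticOnNhd_eq_pow_mul {U : Set ℂ} {F : ℂ → ℂ}
    (hF : AnalyticOnNhd ℂ F U) {c : ℂ} (hc : c ∈ U) {n : ℕ}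
    (h : ∀ m < n, iteratedDeriv m F c = 0) :
    ∃ G : ℂ → ℂ, AnalyticOnNhd ℂ G U ∧ ∀ z ≠ c, F z = (z - c) ^ n * G z := by
  obtain ⟨g, hg, hFg⟩ := (natCast_le_analyticOrderAt (hF c hc)).1
    ((natCast_le_analyticOrderAt_iff_iteratedDeriv_eq_zero (hF c hc)).2 h)
  set G : ℂ → ℂ := Function.update (fun z => F z / (z - c) ^ n) c (g c) with hG
  have hG_ne {z : ℂ} (hz : z ≠ c) : G z = F z / (z - c) ^ n := Function.update_of_ne hz _ _
  have hpow {z : ℂ} (hz : z ≠ c) : (z - c) ^ n ≠ 0 := pow_ne_zero n (sub_ne_zero.2 hz)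
  refine ⟨G, fun z hz => ?_, fun z hz => by rw [hG_ne hz, mul_div_cancel₀ _ (hpow hz)]⟩
  rcases eq_or_ne z c with rfl | hzc
  · refine hg.congr (hFg.mono fun w hw => ?_)
    rcases eq_or_ne w z with rfl | hwz
    · simp [hG]
    · rw [hG_ne hwz, hw, smul_eq_mul, mul_div_cancel_left₀ _ (hpow hwz)]
  · have hdiv : AnalyticAt ℂ (fun w => F w / (w - c) ^ n) z :=
      (hF z hz).fun_div (by fun_prop) (hpow hzc)
    exact hdiv.congr ((eventually_ne_nhds hzc).mono fun w hw => (hG_ne hw).symm)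

section AnalyticRootIntegral

variable {a b : ℝ} {p : ℕ} {K B : ℂ}

theorem exists_eqOn_rootIntegral_iff (ha : a < 0) (ha' : -1 < a) (hb : b < -1) (hp : 0 < p)
    (hK : K ≠ 0) :
    (∃ F : ℂ → ℂ, AnalyticOnNhd ℂ F (ball 0 1) ∧ EqOn F (rootIntegral a b p K B) (slitBall a)) ↔
      ∃ m : ℕ, B = m ∧ p ≤ m := by
  have ha0 : (a : ℂ) ≠ 0 := mod_cast ha.ne
  have hb0 : (b : ℂ) ≠ 0 := mod_cast (hb.trans (by norm_num)).ne
  have hab : (a : ℂ) ≠ b := mod_cast (hb.trans ha').ne'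
  constructor
  · rintro ⟨F, hF, hFI⟩
    obtain ⟨hF0, hode⟩ := (eqOn_rootIntegral_iff ha ha' hb hF).1 hFI
    have ha_mem : (a : ℂ) ∈ ball (0 : ℂ) 1 := by simp [abs_lt, ha', ha.trans one_pos]
    obtain ⟨k, hk⟩ := exists_eq_add_natCast_of_fuchsOp_eq isOpen_ball
      (convex_ball (0 : ℂ) 1).isPreconnected hab ha_mem hF hode (mem_ball_self one_pos) ha0 hb0 hp
      hK hF0
    exact ⟨p + k, by rw [hk, Nat.cast_add], Nat.le_add_right p k⟩
  · rintro ⟨m, rfl, hpm⟩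
    have hb_notMem : (b : ℂ) ∉ ball (0 : ℂ) 1 := by simp [le_abs, le_neg.2 hb.le]
    obtain ⟨F, hF, hF0, hode⟩ := exists_analyticOnNhd_fuchsOp_eq isOpen_ball ha0 hb0 hab hb_notMem
      (Nat.lt_of_lt_of_le (Nat.pred_lt hp.ne') hpm) (K * p)
    rw [Nat.pred_eq_sub_one, Nat.cast_pred hp] at hode
    exact ⟨F, hF, (eqOn_rootIntegral_iff ha ha' hb hF).2 ⟨hF0, hode⟩⟩

theorem exists_eqOn_rootIntegral_div_pow_iff (ha : a < 0) (ha' : -1 < a) (hb : b < -1)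
    (hp : 0 < p) (hK : K ≠ 0) :
    (∃ G : ℂ → ℂ, AnalyticOnNhd ℂ G (ball 0 1) ∧
      EqOn G (fun z => rootIntegral a b p K B z / z ^ p) (slitBall a)) ↔
      ∃ m : ℕ, B = m ∧ p ≤ m := by
  rw [← exists_eqOn_rootIntegral_iff ha ha' hb hp hK]
  constructor
  · rintro ⟨G, hG, hGI⟩
    refine ⟨fun z => z ^ p * G z, fun z hz => (analyticAt_id.pow p).mul (hG z hz), fun z hz => ?_⟩
    simp only [hGI hz]
    exact mul_div_cancel₀ _ (pow_ne_zero p hz.2.1)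
  · rintro ⟨F, hF, hFI⟩
    have h0 : (0 : ℂ) ∈ ball (0 : ℂ) 1 := mem_ball_self one_pos
    obtain ⟨hF0, hode⟩ := (eqOn_rootIntegral_iff ha ha' hb hF).1 hFI
    have hderiv := (iteratedDeriv_zero_of_fuchsOp_eq (mod_cast ha.ne)
      (mod_cast (hb.trans (by norm_num)).ne) (hF 0 h0) hF0
      ((isOpen_ball.eventually_mem h0).mono hode)).1
    obtain ⟨G, hG, hFG⟩ := exists_analyticOnNhd_eq_pow_mul hF h0
      fun m hm => hderiv m (Nat.le_pred_of_lt hm)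
    refine ⟨G, hG, fun z hz => ?_⟩
    simp only [← hFI hz, hFG z hz.2.1, sub_zero]
    exact (mul_div_cancel_left₀ _ (pow_ne_zero p hz.2.1)).symm

end AnalyticRootIntegral

/-! ### The point spectrum -/

theorem isFibreSolution_zero (β γ : ℂ) (p : ℕ) (E : ℂ) : IsFibreSolution β γ p E 0 := by
  simp [IsFibreSolution]

theorem isFibreSolution_pow {β γ r : ℂ} (hr : β * r ^ 2 + r + γ = 0) (p : ℕ) :
    IsFibreSolution β γ p (p / 2 + β * (p + 1) * r) (fun s => r ^ s) := by
  rintro (- | s)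
  · simp only [Nat.cast_zero]
    ring
  · rw [Nat.add_sub_cancel]
    push_cast
    linear_combination (s + 1) * r ^ s * hr

/-- The vector on the fibre `fibrePos p` whose rescaled coefficients are the powers of `r`. For a
root `r` of `β r ^ 2 + r + γ` it is an eigenvector of `pairOperator β γ`. -/
noncomputable def geometricVector (p : ℕ) (r : ℂ) : Formal := fun x =>
  if x.1 = p + x.2 then √(((p + x.2)! : ℝ) / (x.2 ! : ℝ)) * r ^ x.2 else 0

theorem geometricVector_fibrePos (p : ℕ) (r : ℂ) (s : ℕ) :
    geometricVector p r (fibrePos p s) = √(((p + s)! : ℝ) / (s ! : ℝ)) * r ^ s :=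
  if_pos rfl

theorem geometricVector_of_notMem_range {p : ℕ} (r : ℂ) {x : ℕ × ℕ} (hx : x ∉ range (fibrePos p)) :
    geometricVector p r x = 0 :=
  if_neg fun h => hx ⟨x.2, Prod.ext h.symm rfl⟩

theorem memℓp_geometricVector (p : ℕ) {r : ℂ} (hr : ‖r‖ < 1) : Memℓp (geometricVector p r) 2 := by
  have hinj : Function.Injective (fibrePos p) := fun s t h => congrArg Prod.snd h
  refine memℓp_gen ((hinj.summable_iff fun x hx => ?_).1 ?_)
  · simp [geometricVector_of_notMem_range r hx]
  have hr2 : ‖‖r‖ ^ 2‖ < 1 := by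
    rw [norm_pow, norm_norm]
    exact pow_lt_one₀ (norm_nonneg r) hr two_ne_zero
  refine (summable_descFactorial_mul_geometric_of_norm_lt_one p hr2).congr fun s => ?_
  have hfact : (s ! : ℝ) * (s + p).descFactorial p = (p + s)! := by
    have h := Nat.factorial_mul_descFactorial (Nat.le_add_left p s)
    rw [Nat.add_sub_cancel] at h
    rw [add_comm p s]
    exact_mod_cast h
  have hweight : √(((p + s)! : ℝ) / (s ! : ℝ)) ^ 2 = (s + p).descFactorial p := by
    rw [Real.sq_sqrt (by positivity), ← hfact, mul_div_cancel_left₀ _ (by positivity)]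
  rw [Function.comp_apply, geometricVector_fibrePos, ENNReal.toReal_ofNat, Real.rpow_ofNat,
    norm_mul, mul_pow, Complex.norm_of_nonneg (Real.sqrt_nonneg _), hweight, norm_pow,
    pow_right_comm]

/-- The formal vector `geometricVector p r` as a vector of the Fock space, for `‖r‖ < 1`. -/
noncomputable def geometricState (p : ℕ) {r : ℂ} (hr : ‖r‖ < 1) : Fock :=
  ⟨geometricVector p r, memℓp_geometricVector p hr⟩

theorem rescaledCoeff_geometricState (p : ℕ) {r : ℂ} (hr : ‖r‖ < 1) :
    rescaledCoeff p (fibrePos p) (geometricState p hr) = fun s => r ^ s := by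
  funext s
  have hweight : √((s ! : ℝ) / ((p + s)! : ℝ)) * √(((p + s)! : ℝ) / (s ! : ℝ)) = 1 := by
    rw [← Real.sqrt_mul (by positivity), div_mul_div_cancel₀ (by positivity),
      div_self (by positivity), Real.sqrt_one]
  rw [rescaledCoeff]
  refine (congrArg _ (geometricVector_fibrePos p r s)).trans ?_
  rw [← mul_assoc, ← Complex.ofReal_mul, hweight, Complex.ofReal_one, one_mul]

theorem isFibreSolution_rescaledCoeff_geometricState {β γ r : ℂ}
    (hβ : β * r ^ 2 + r + γ = 0) (hr : ‖r‖ < 1) (p : ℕ) {q : ℕ} {ι : ℕ → ℕ × ℕ}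
    (hι : ι = fibrePos q ∨ ι = fibreNeg q) :
    IsFibreSolution β γ q (p / 2 + β * (p + 1) * r)
      (rescaledCoeff q ι (geometricState p hr)) := by
  by_cases h : ∃ s, ι s ∈ range (fibrePos p)
  · obtain ⟨rfl, rfl⟩ : q = p ∧ ι = fibrePos q := by
      obtain ⟨s, t, hst⟩ := h
      rcases hι with rfl | rfl <;> simp only [fibrePos, fibreNeg, Prod.mk.injEq] at hst
      · exact ⟨by lia, rfl⟩
      · obtain rfl : q = 0 := by lia
        exact ⟨by lia, funext fun s => by simp [fibrePos, fibreNeg]⟩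
    rw [rescaledCoeff_geometricState q hr]
    exact isFibreSolution_pow hβ q
  · have hzero : rescaledCoeff q ι (geometricState p hr) = 0 := funext fun s =>
      rescaledCoeff_eq_zero_iff.2 (geometricVector_of_notMem_range r fun hs => h ⟨s, hs⟩)
    rw [hzero]
    exact isFibreSolution_zero β γ q _

theorem isEigenstate_geometricState {β γ r : ℂ} (hβ : β * r ^ 2 + r + γ = 0) (hr : ‖r‖ < 1)
    (p : ℕ) : IsEigenstate (realize (pairOperator β γ)) (p / 2 + β * (p + 1) * r)
      (geometricState p hr) := by
  refine isEigenstate_pairOperator_iff.2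
    ⟨fun h => ?_, fun q ι hι => isFibreSolution_rescaledCoeff_geometricState hβ hr p hι⟩
  have h0 := congrFun (rescaledCoeff_geometricState p hr) 0
  rw [h] at h0
  simp [rescaledCoeff] at h0

theorem IsRootPair.pointSpectrum_pairOperator {β γ a b : ℝ} (hr : IsRootPair β γ a b) :
    pointSpectrum (realize (pairOperator β γ)) =
      range fun N : ℕ => (((γ * (a - b) - 1) / 2 + γ * (a - b) / 2 * N : ℝ) : ℂ) := by
  refine Subset.antisymm ?_ (range_subset_iff.2 fun N => ?_)
  · rintro E ⟨Ψ, hΨ⟩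
    obtain ⟨hne, hsol⟩ := isEigenstate_pairOperator_iff.1 hΨ
    obtain ⟨x, hx⟩ : ∃ x, Ψ x ≠ 0 := by
      by_contra! h
      exact hne (lp.ext (funext h))
    obtain ⟨p, ι, s, hι, rfl⟩ := exists_fibre x
    obtain ⟨k, hk⟩ := hr.exists_energy_eq (hsol p ι hι) (norm_rescaledCoeff_le p ι Ψ)
      (rescaledCoeff_zero_ne_zero (mod_cast hr.β_pos.ne') (hsol p ι hι) hx)
    exact ⟨p + 2 * k, by rw [hk]; push_cast; rfl⟩
  · have hb : (b : ℂ) ≠ 0 := mod_cast (hr.lt.trans hr.neg).ne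
    have hsum : (γ : ℂ) * (a + b) = -1 := mod_cast hr.sum
    have hprod : (γ : ℂ) * (a * b) = β := mod_cast hr.prod
    have hroot : (β : ℂ) * (b : ℂ)⁻¹ ^ 2 + (b : ℂ)⁻¹ + γ = 0 := by
      field_simp
      linear_combination b * hsum - hprod
    have hnorm : ‖(b : ℂ)⁻¹‖ < 1 := by
      rw [norm_inv, Complex.norm_real, Real.norm_of_nonpos (hr.lt.trans hr.neg).le]
      exact inv_lt_one_of_one_lt₀ (lt_neg.2 hr.lt_neg_one)
    refine ⟨geometricState N hnorm, ?_⟩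
    convert isEigenstate_geometricState hroot hnorm N using 1
    push_cast
    rw [← hprod]
    field_simp
    linear_combination -((N : ℂ) + 1) * hsum

/-! ### The parameters of the two Hamiltonians -/

section Parameters

variable {y α : ℝ}

theorem two_mul_mul_alphaC (hy : y ≠ 0) : 2 * y * alphaC y = 1 - √(1 - 4 * y ^ 2) :=
  mul_div_cancel₀ _ (mul_ne_zero two_ne_zero hy)

theorem zPlus_zero (y : ℝ) : zPlus y 0 = -alphaC y := by
  simp only [zPlus, alphaC, y₁, y₂, mul_zero, zero_mul, sub_zero, div_one, add_zero, zero_pow,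
    ne_eq, OfNat.ofNat_ne_zero, not_false_eq_true]
  ring_nf

theorem y₂_mul_sub (h : y₂ y α ≠ 0) :
    y₂ y α * (zPlus y α - zMinus y α) = √(1 - 4 * y₁ y α * y₂ y α) := by
  rw [zPlus, zMinus]
  field_simp
  ring

theorem exponentB_eq_rootExponent
    (hr : IsRootPair (y₁ y α) (y₂ y α) (zPlus y α) (zMinus y α)) (p : ℕ) (E : ℂ) :
    exponentB y α p E = rootExponent (y₂ y α) (zPlus y α) (zMinus y α) p E := by
  have hgap : (y₂ y α * (zPlus y α - zMinus y α) : ℂ) ≠ 0 := mod_cast hr.gap_pos.ne'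
  have ha : (zPlus y α : ℂ) ≠ 0 := mod_cast hr.neg.ne
  have hsum : (y₂ y α : ℂ) * (zPlus y α + zMinus y α) = -1 := mod_cast hr.sum
  have hprod : (y₂ y α : ℂ) * (zPlus y α * zMinus y α) = y₁ y α := mod_cast hr.prod
  have hden : (zPlus y α : ℂ) + 2 * y₁ y α =
      -(zPlus y α * (y₂ y α * (zPlus y α - zMinus y α))) := by
    linear_combination -2 * hprod + zPlus y α * hsum
  rw [exponentB, rootExponent, hden, div_eq_div_iff (neg_ne_zero.2 (mul_ne_zero ha hgap)) hgap,
    ← hprod]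
  linear_combination ((p : ℂ) - 1) * zPlus y α * (y₂ y α * (zPlus y α - zMinus y α)) * hsum

theorem integralFormula_eq_rootIntegral (y α : ℝ) (p : ℕ) (C₀ B : ℂ) :
    integralFormula y α p C₀ B =
      rootIntegral (zPlus y α) (zMinus y α) p (C₀ * y₁ y α / y₂ y α) B := by
  funext z
  rw [integralFormula, mul_div_right_comm]
  rfl

theorem discriminant_eq (h : 1 - 2 * α * y ≠ 0) :
    1 - 4 * y₁ y α * y₂ y α = (1 - 4 * y ^ 2) / (1 - 2 * α * y) ^ 2 := by
  have hy₁ : y₁ y α * (1 - 2 * α * y) = y := div_mul_cancel₀ _ h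
  have hy₂ : y₂ y α * (1 - 2 * α * y) = y - α + α ^ 2 * y := div_mul_cancel₀ _ h
  rw [eq_div_iff (pow_ne_zero 2 h)]
  linear_combination -4 * (y₂ y α * (1 - 2 * α * y)) * hy₁ - 4 * y * hy₂

section Stable

variable (hy₀ : 0 < y) (hy₁ : y < 1 / 2)
include hy₀ hy₁

theorem sqrt_one_sub_four_mul_sq_pos : 0 < √(1 - 4 * y ^ 2) :=
  Real.sqrt_pos.2 (by nlinarith)

theorem mul_one_add_alphaC_sq : y * (1 + alphaC y ^ 2) = alphaC y := by
  have h := two_mul_mul_alphaC hy₀.ne'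
  have hsq : √(1 - 4 * y ^ 2) ^ 2 = 1 - 4 * y ^ 2 := Real.sq_sqrt (by nlinarith)
  refine mul_left_cancel₀ (mul_ne_zero four_ne_zero hy₀.ne') ?_
  linear_combination (2 * y * alphaC y - 1 - √(1 - 4 * y ^ 2)) * h + hsq

theorem alphaC_pos : 0 < alphaC y := by
  rw [← mul_one_add_alphaC_sq hy₀ hy₁]
  positivity

theorem alphaC_lt_one : alphaC y < 1 := by
  have h := two_mul_mul_alphaC hy₀.ne'
  have hκ := sqrt_one_sub_four_mul_sq_pos hy₀ hy₁
  have hc := mul_one_add_alphaC_sq hy₀ hy₁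
  have := alphaC_pos hy₀ hy₁
  nlinarith

variable (hα : α < alphaC y)
include hα

theorem one_sub_two_mul_mul_pos : 0 < 1 - 2 * α * y := by
  have h := two_mul_mul_alphaC hy₀.ne'
  have hκ := sqrt_one_sub_four_mul_sq_pos hy₀ hy₁
  nlinarith

theorem one_sub_mul_alphaC_pos : 0 < 1 - α * alphaC y := by
  have := alphaC_pos hy₀ hy₁
  have := alphaC_lt_one hy₀ hy₁
  nlinarith

theorem y₂_pos : 0 < y₂ y α := by
  refine div_pos ?_ (one_sub_two_mul_mul_pos hy₀ hy₁ hα)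
  have hfactor : (1 + alphaC y ^ 2) * (y - α + α ^ 2 * y) =
      (alphaC y - α) * (1 - α * alphaC y) := by
    linear_combination (1 + α ^ 2) * mul_one_add_alphaC_sq hy₀ hy₁
  refine pos_of_mul_pos_right ?_ (show 0 ≤ 1 + alphaC y ^ 2 by positivity)
  rw [hfactor]
  exact mul_pos (sub_pos.2 hα) (one_sub_mul_alphaC_pos hy₀ hy₁ hα)

theorem sqrt_discriminant :
    √(1 - 4 * y₁ y α * y₂ y α) = √(1 - 4 * y ^ 2) / (1 - 2 * α * y) := by
  have h := one_sub_two_mul_mul_pos hy₀ hy₁ hα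
  rw [discriminant_eq h.ne', Real.sqrt_div' _ (sq_nonneg _), Real.sqrt_sq h.le]

theorem zMinus_eq : zMinus y α = -1 / (alphaC y - α) := by
  have hD := one_sub_two_mul_mul_pos hy₀ hy₁ hα
  have hy₂ := y₂_pos hy₀ hy₁ hα
  have hsqrt : √(1 - 4 * y ^ 2) / (1 - 2 * α * y) * (1 - 2 * α * y) = √(1 - 4 * y ^ 2) :=
    div_mul_cancel₀ _ hD.ne'
  have hy₂_mul : y₂ y α * (1 - 2 * α * y) = y - α + α ^ 2 * y := div_mul_cancel₀ _ hD.ne'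
  rw [zMinus, sqrt_discriminant hy₀ hy₁ hα,
    div_eq_div_iff (mul_ne_zero two_ne_zero hy₂.ne') (sub_pos.2 hα).ne']
  refine mul_right_cancel₀ hD.ne' ?_
  linear_combination -(alphaC y - α) * hsqrt + 2 * hy₂_mul -
    (alphaC y - α) * two_mul_mul_alphaC hy₀.ne' + 2 * mul_one_add_alphaC_sq hy₀ hy₁

theorem zMinus_lt_neg_one (hα' : alphaC y - 1 < α) : zMinus y α < -1 := by
  rw [zMinus_eq hy₀ hy₁ hα, div_lt_iff₀ (sub_pos.2 hα)]
  linarith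

theorem isRootPair_zPlus_zMinus (hα' : alphaC y - 1 < α) (hz : |zPlus y α| < 1) :
    IsRootPair (y₁ y α) (y₂ y α) (zPlus y α) (zMinus y α) := by
  have hD := one_sub_two_mul_mul_pos hy₀ hy₁ hα
  have hy₁_pos : 0 < y₁ y α := div_pos hy₀ hD
  have hy₂ := y₂_pos hy₀ hy₁ hα
  have hb := zMinus_lt_neg_one hy₀ hy₁ hα hα'
  have hdisc : √(1 - 4 * y₁ y α * y₂ y α) ^ 2 = 1 - 4 * y₁ y α * y₂ y α := by
    refine Real.sq_sqrt ?_
    rw [discriminant_eq hD.ne']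
    exact div_nonneg (by nlinarith) (sq_nonneg _)
  have hprod : y₂ y α * (zPlus y α * zMinus y α) = y₁ y α := by
    rw [zPlus, zMinus]
    generalize √(1 - 4 * y₁ y α * y₂ y α) = r at hdisc
    field_simp
    linear_combination -hdisc
  have hsum : y₂ y α * (zPlus y α + zMinus y α) = -1 := by
    rw [zPlus, zMinus]
    field_simp
    ring
  refine ⟨hy₂, hsum, hprod, (abs_lt.1 hz).1, ?_, hb⟩
  have hpos : 0 < zPlus y α * zMinus y α := pos_of_mul_pos_right (hprod ▸ hy₁_pos) hy₂.le
  exact neg_of_mul_pos_left hpos (by linarith)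

end Stable

end Parameters

theorem isClosedEmbedding_arithmeticProgression (c : ℝ) {d : ℝ} (hd : d ≠ 0) :
    IsClosedEmbedding fun N : ℕ => ((c + d * N : ℝ) : ℂ) := by
  have haffine := ((Homeomorph.mulLeft₀ d hd).trans (Homeomorph.addLeft c)).isClosedEmbedding
  exact Complex.isometry_ofReal.isClosedEmbedding.comp
    (haffine.comp Nat.isClosedEmbedding_coe_real)

theorem bogoliubovSpectrum_eq_range (y : ℝ) :
    bogoliubovSpectrum y =
      range fun N : ℕ => (((√(1 - 4 * y ^ 2) - 1) / 2 + √(1 - 4 * y ^ 2) / 2 * N : ℝ) : ℂ) := by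
  ext E
  constructor
  · rintro ⟨na, nb, rfl⟩
    exact ⟨na + nb, by push_cast; ring⟩
  · rintro ⟨N, rfl⟩
    exact ⟨N, 0, by push_cast; ring⟩

section RootPair

variable {y α : ℝ} {p : ℕ} {ι : ℕ → ℕ × ℕ} {C₀ B E : ℂ} {Ψ : Fock}

theorem IsRootPair.analyticInDisk_genFun_iff
    (hr : IsRootPair (y₁ y α) (y₂ y α) (zPlus y α) (zMinus y α)) (hp : 0 < p) (hC₀ : C₀ ≠ 0) :
    AnalyticInDisk y α (genFun y α p C₀ B) ↔ ∃ m : ℕ, B = m ∧ p ≤ m := by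
  have hK : C₀ * y₁ y α / y₂ y α ≠ 0 :=
    div_ne_zero (mul_ne_zero hC₀ (mod_cast hr.β_pos.ne')) (mod_cast hr.pos.ne')
  rw [← exists_eqOn_rootIntegral_div_pow_iff hr.neg hr.neg_one_lt hr.lt_neg_one hp hK,
    ← integralFormula_eq_rootIntegral]
  rfl

theorem IsRootPair.analyticInDisk_integralFormula_iff
    (hr : IsRootPair (y₁ y α) (y₂ y α) (zPlus y α) (zMinus y α)) (hp : 0 < p) (hC₀ : C₀ ≠ 0) :
    AnalyticInDisk y α (integralFormula y α p C₀ B) ↔ ∃ m : ℕ, B = m ∧ p ≤ m := by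
  have hK : C₀ * y₁ y α / y₂ y α ≠ 0 :=
    div_ne_zero (mul_ne_zero hC₀ (mod_cast hr.β_pos.ne')) (mod_cast hr.pos.ne')
  rw [← exists_eqOn_rootIntegral_iff hr.neg hr.neg_one_lt hr.lt_neg_one hp hK,
    ← integralFormula_eq_rootIntegral]
  rfl

theorem IsRootPair.hasSum_genFun
    (hr : IsRootPair (y₁ y α) (y₂ y α) (zPlus y α) (zMinus y α)) (hp : 0 < p)
    {C : ℕ → ℂ} (hC : IsFibreSolution (y₁ y α) (y₂ y α) p E C) {M : ℝ} (hM : ∀ s, ‖C s‖ ≤ M)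
    {z : ℂ} (hz : z ∈ slitDisk y α) :
    HasSum (fun s => C s * z ^ s) (genFun y α p (C 0) (exponentB y α p E) z) := by
  have hgen : genSeries p C z = integralFormula y α p (C 0) (exponentB y α p E) z := by
    rw [integralFormula_eq_rootIntegral, exponentB_eq_rootExponent hr]
    exact (eqOn_rootIntegral_iff hr.neg hr.neg_one_lt hr.lt_neg_one
      (analyticOnNhd_genSeries hM p)).2
      ⟨genSeries_apply_zero hp C, fun w hw => hr.fuchsOp_genSeries hC hM hw⟩ hz
  have hsum := (hasSum_genSeries hM p hz.1).div_const (z ^ p)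
  rw [hgen] at hsum
  refine hsum.congr_fun fun s => ?_
  rw [pow_add, mul_left_comm, mul_div_cancel_left₀ _ (pow_ne_zero p hz.2.1)]

end RootPair

section Stable

variable {y α : ℝ} (hy₀ : 0 < y) (hy₁ : y < 1 / 2)
include hy₀ hy₁

theorem pointSpectrum_transformedHamiltonian (hα : α < alphaC y) (hα' : alphaC y - 1 < α)
    (hz : |zPlus y α| < 1) :
    pointSpectrum (realize (transformedHamiltonian y α)) =
      range fun N : ℕ => (((√(1 - 4 * y ^ 2) / (1 - 2 * α * y) - 1) / 2 +
        √(1 - 4 * y ^ 2) / (1 - 2 * α * y) / 2 * N : ℝ) : ℂ) := by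
  rw [transformedHamiltonian_eq_pairOperator (one_sub_two_mul_mul_pos hy₀ hy₁ hα).ne',
    (isRootPair_zPlus_zMinus hy₀ hy₁ hα hα' hz).pointSpectrum_pairOperator,
    y₂_mul_sub (y₂_pos hy₀ hy₁ hα).ne', sqrt_discriminant hy₀ hy₁ hα]

theorem pointSpectrum_hamiltonian :
    pointSpectrum (realize (hamiltonian y)) = bogoliubovSpectrum y := by
  have hc := alphaC_pos hy₀ hy₁
  have hc' := alphaC_lt_one hy₀ hy₁
  have hz : |zPlus y 0| < 1 := by rwa [zPlus_zero, abs_neg, abs_of_pos hc]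
  have hH : hamiltonian y = transformedHamiltonian y 0 := by
    rw [hamiltonian_eq_pairOperator, transformedHamiltonian_eq_pairOperator (by norm_num)]
    norm_num [y₁, y₂]
  rw [hH, pointSpectrum_transformedHamiltonian hy₀ hy₁ hc (by linarith) hz,
    bogoliubovSpectrum_eq_range]
  norm_num

theorem isClosed_and_discreteTopology_pointSpectrum_transformedHamiltonian
    (hα : α < alphaC y) (hα' : alphaC y - 1 < α) (hz : |zPlus y α| < 1) :
    IsClosed (pointSpectrum (realize (transformedHamiltonian y α))) ∧
      DiscreteTopology (pointSpectrum (realize (transformedHamiltonian y α))) := by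
  have hgap : √(1 - 4 * y ^ 2) / (1 - 2 * α * y) / 2 ≠ 0 :=
    (half_pos (div_pos (sqrt_one_sub_four_mul_sq_pos hy₀ hy₁)
      (one_sub_two_mul_mul_pos hy₀ hy₁ hα))).ne'
  have hemb := isClosedEmbedding_arithmeticProgression
    ((√(1 - 4 * y ^ 2) / (1 - 2 * α * y) - 1) / 2) hgap
  rw [pointSpectrum_transformedHamiltonian hy₀ hy₁ hα hα' hz]
  exact ⟨hemb.isClosed_range, hemb.isEmbedding.toHomeomorph.symm.isEmbedding.discreteTopology⟩

theorem image_pointSpectrum_transformedHamiltonian (hα : α < alphaC y) (hα' : alphaC y - 1 < α)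
    (hz : |zPlus y α| < 1) :
    (fun E : ℂ => (1 - 2 * α * y) * E - α * y) ''
        pointSpectrum (realize (transformedHamiltonian y α)) =
      bogoliubovSpectrum y := by
  have hD : (1 - 2 * α * y : ℂ) ≠ 0 := mod_cast (one_sub_two_mul_mul_pos hy₀ hy₁ hα).ne'
  have hgap : (1 - 2 * α * y : ℂ) * (√(1 - 4 * y ^ 2) / (1 - 2 * α * y)) = √(1 - 4 * y ^ 2) :=
    mul_div_cancel₀ _ hD
  rw [pointSpectrum_transformedHamiltonian hy₀ hy₁ hα hα' hz, bogoliubovSpectrum_eq_range,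
    ← range_comp]
  congr 1
  funext N
  simp only [Function.comp_apply]
  push_cast
  linear_combination (1 / 2 + (N : ℂ) / 2) * hgap

theorem IsEigenstate.rescaledCoeff_zero_ne_zero_and_hasSum {p : ℕ} {ι : ℕ → ℕ × ℕ}
    {E : ℂ} {Ψ : Fock} (hΨ : IsEigenstate (realize (transformedHamiltonian y α)) E Ψ)
    (hα : α < alphaC y) (hα' : alphaC y - 1 < α) (hz : |zPlus y α| < 1)
    (hp : 0 < p) (hι : ι = fibrePos p ∨ ι = fibreNeg p)
    (hsupp : ∀ x, x ∉ range ι → Ψ x = 0) :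
    rescaledCoeff p ι Ψ 0 ≠ 0 ∧ ∀ z ∈ slitDisk y α, HasSum (fun s => rescaledCoeff p ι Ψ s * z ^ s)
        (genFun y α p (rescaledCoeff p ι Ψ 0) (exponentB y α p E) z) := by
  have hr := isRootPair_zPlus_zMinus hy₀ hy₁ hα hα' hz
  rw [transformedHamiltonian_eq_pairOperator (one_sub_two_mul_mul_pos hy₀ hy₁ hα).ne'] at hΨ
  obtain ⟨hne, hsol⟩ := isEigenstate_pairOperator_iff.1 hΨ
  obtain ⟨s, hs⟩ : ∃ s, Ψ (ι s) ≠ 0 := by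
    by_contra! h
    refine hne (lp.ext (funext fun x => ?_))
    by_cases hx : x ∈ range ι
    · obtain ⟨s, rfl⟩ := hx
      exact h s
    · exact hsupp x hx
  exact ⟨rescaledCoeff_zero_ne_zero (mod_cast hr.β_pos.ne') (hsol p ι hι) hs,
    fun z hz => hr.hasSum_genFun hp (hsol p ι hι) (norm_rescaledCoeff_le p ι Ψ) hz⟩

end Stable

end TwoSpecies

theorem mainTheorem2_general (y α : ℝ) (hy₀ : 0 < y) (hy₁ : y < 1 / 2)
    (hα₀ : alphaC y - 1 < α) (hα₁ : α < alphaC y) (hz : |zPlus y α| < 1) :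
    (∀ (p : ℕ) (C₀ B : ℂ), 0 < p → C₀ ≠ 0 →
      (AnalyticInDisk y α (genFun y α p C₀ B) ↔ ∃ m : ℕ, B = m ∧ p ≤ m) ∧
      (AnalyticInDisk y α (integralFormula y α p C₀ B) ↔ ∃ m : ℕ, B = m ∧ p ≤ m)) ∧
    (∀ (p : ℕ) (ι : ℕ → ℕ × ℕ) (E : ℂ) (Ψ : Fock), 0 < p → (ι = fibrePos p ∨ ι = fibreNeg p) →
      (∀ x, x ∉ Set.range ι → Ψ x = 0) →
      IsEigenstate (realize (transformedHamiltonian y α)) E Ψ →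
      rescaledCoeff p ι Ψ 0 ≠ 0 ∧
      ∀ z ∈ slitDisk y α, HasSum (fun s => rescaledCoeff p ι Ψ s * z ^ s)
        (genFun y α p (rescaledCoeff p ι Ψ 0) (exponentB y α p E) z)) ∧
    (IsClosed (pointSpectrum (realize (transformedHamiltonian y α))) ∧
      DiscreteTopology (pointSpectrum (realize (transformedHamiltonian y α)))) ∧
    (fun E : ℂ => (1 - 2 * α * y) * E - α * y) ''
        pointSpectrum (realize (transformedHamiltonian y α)) =
      pointSpectrum (realize (hamiltonian y)) ∧
    pointSpectrum (realize (hamiltonian y)) = bogoliubovSpectrum y := by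
  have hr := isRootPair_zPlus_zMinus hy₀ hy₁ hα₁ hα₀ hz
  refine ⟨fun p C₀ B hp hC₀ =>
      ⟨hr.analyticInDisk_genFun_iff hp hC₀, hr.analyticInDisk_integralFormula_iff hp hC₀⟩,
    fun p ι E Ψ hp hι hsupp hΨ =>
      hΨ.rescaledCoeff_zero_ne_zero_and_hasSum hy₀ hy₁ hα₁ hα₀ hz hp hι hsupp,
    isClosed_and_discreteTopology_pointSpectrum_transformedHamiltonian hy₀ hy₁ hα₁ hα₀ hz, ?_,
    pointSpectrum_hamiltonian hy₀ hy₁⟩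
  rw [pointSpectrum_hamiltonian hy₀ hy₁,
    image_pointSpectrum_transformedHamiltonian hy₀ hy₁ hα₁ hα₀ hz]

theorem mainTheorem2 (y α : ℝ) (hy₀ : 0 < y) (hy₁ : y < 1 / 2)
    (hα₀ : 0 ≤ α) (hα₁ : α < alphaC y) (hz : |zPlus y α| < 1) :
    -- analyticity of the explicit formula, with and without the factor `z ^ (-p)`
    (∀ (p : ℕ) (C₀ B : ℂ), 0 < p → C₀ ≠ 0 →
      (AnalyticInDisk y α (genFun y α p C₀ B) ↔ ∃ m : ℕ, B = m ∧ p ≤ m) ∧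
      (AnalyticInDisk y α (integralFormula y α p C₀ B) ↔ ∃ m : ℕ, B = m ∧ p ≤ m)) ∧
    -- the formula is the generating function of an eigenstate of energy `E`
    (∀ (p : ℕ) (ι : ℕ → ℕ × ℕ) (E : ℂ) (Ψ : Fock), 0 < p → (ι = fibrePos p ∨ ι = fibreNeg p) →
      (∀ x, x ∉ Set.range ι → Ψ x = 0) →
      IsEigenstate (realize (transformedHamiltonian y α)) E Ψ →
      rescaledCoeff p ι Ψ 0 ≠ 0 ∧
      ∀ z ∈ slitDisk y α, HasSum (fun s => rescaledCoeff p ι Ψ s * z ^ s)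
        (genFun y α p (rescaledCoeff p ι Ψ 0) (exponentB y α p E) z)) ∧
    -- the eigenvalues are discrete
    (IsClosed (pointSpectrum (realize (transformedHamiltonian y α))) ∧
      DiscreteTopology (pointSpectrum (realize (transformedHamiltonian y α)))) ∧
    -- and give the Bogoliubov spectrum
    (fun E : ℂ => (1 - 2 * α * y) * E - α * y) ''
        pointSpectrum (realize (transformedHamiltonian y α)) =
      pointSpectrum (realize (hamiltonian y)) ∧
    pointSpectrum (realize (hamiltonian y)) = bogoliubovSpectrum y :=
  mainTheorem2_general y α hy₀ hy₁ (by linarith [alphaC_lt_one hy₀ hy₁]) hα₁ hz
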